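/- Let $N=\mathbb Z^d$, $M=\operatorname{Hom}(N,\mathbb Z)\cong\mathbb Z^d$, and let $\Delta\subset M_{\mathbb R}$ be a reflexive polytope (a lattice polytope with $0$ in its interior whose dual $\Delta^*=\{n\in N_{\mathbb R}\mid \langle m,n\rangle\ge -1\ \forall m\in\Delta\}$ is a lattice polytope), written as a Minkowski sum $\Delta=\Delta_0+\dots+\Delta_k$ of lattice polytopes. Put $\min\langle P,n\rangle=\min_{m\in P}\langle m,n\rangle$. Let $$\sigma=\{(t\Delta,t)\mid t\ge0\}\subset M_{\mathbb R}\oplus\mathbb R,\qquad \bar\sigma=\Bigl\{\bigl(\textstyle\sum_i t_i\Delta_i,\ t_0,\dots,t_k\bigr)\Bigm| t_i\ge 0\Bigr\}\subset M_{\mathbb R}\oplus\mathbb R^{k+1},$$ let $\bar N=N\oplus\mathbb Z^{k+1}$ with the standard basis $r_0^*,\dots,r_k^*$ of $\mathbb Z^{k+1}$, and let $A=\mathbb C[\sigma^\vee\cap(N\oplus\mathbb Z)]$, $\bar A=\mathbb C[\bar\sigma^\vee\cap\bar N]$ be the semigroup rings of the lattice points of the dual cones. They are graded by $\deg\chi^{(n,\alpha)}=\alpha$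 and $\deg\chi^{(n,\alpha_0,\dots,\alpha_k)}=\alpha_0+\dots+\alpha_k$. Let $X=X_{\Delta^*}=\operatorname{Proj}A$ and $\bar X=X_{(\tilde\Delta_0\uplus\dots\uplus\tilde\Delta_k)^*}=\operatorname{Proj}\bar A$ be the corresponding projective toric varieties. The map $(n,\alpha_0,\dots,\alpha_k)\mapsto(n,\sum_i\alpha_i)$ induces a surjective graded homomorphism $\bar A\to A$, hence a morphism $\iota:X\to\bar X$. For complex numbers $a_n$, $n\in\Delta^*\cap N$, set $$f=\sum_{n\in\Delta^*\cap N}a_n\chi^{(n,1)}\in A_1,\qquad \bar f=a_0\chi^{r_0^*}+\sum_{0\ne n\in\Delta^*\cap N}a_n\chi^{\,n-\sum_{j=0}^k\min\langle\Delta_j,n\rangle r_j^*}\in\bar A_1,$$ $g_i=\chi^{r_i^*}-\chi^{r_0^*}\in\bar A_1$ for $i=1,\dots,k$, and let $Y=\operatorname{Proj}(A/(f))\subset X$ and $\bar Y=\operatorname{Proj}\bigl(\bar A/(\bar f,g_1,\dots,g_k)\bigr)\subset\bar X$ be the corresponding closed subschemes. **Theorem.** 1. The morphism $\iota:X\hookrightarrow\bar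 X$ is a closed embedding, and it maps the hypersurface $Y$ isomorphically onto $\bar Y$. 2. The graded homomorphism $\bar A\to A/(f)$ is surjective, and its kernel is the ideal $(\bar f,g_1,\dots,g_k)$. 3. $\bar Y$ is a nef Calabi–Yau complete intersection in the following sense. If $f\neq 0$, then $g_1,\dots,g_k,\bar f$ is a regular sequence in $\bar A$. Let $e_1^*,\dots,e_k^*$ be the standard basis of $\mathbb Z^k$, with dual basis $e_1,\dots,e_k$, and $e_0=-(e_1+\dots+e_k)$. Let $\tilde\Delta_i=\operatorname{conv}(\Delta_i+e_i,\,0)\subset M_{\mathbb R}\oplus\mathbb R^k$ and let $\tilde\Delta_0\uplus\dots\uplus\tilde\Delta_k$ be the convex hull of their union. Put $$\hat\nabla_0=\operatorname{conv}\Bigl(\bigl\{u-\textstyle\sum_{j=1}^k\min\langle\Delta_j,u\rangle e_j^*\bigm|u\in\Delta^*\bigr\}\cup\{e_1^*,\dots,e_k^*\}\Bigr),\qquad \hat\nabla_i=\hat\nabla_0-e_i^*\quad(1\le i\le k).$$ Then $(\hat\nabla_0,\dots,\hat\nabla_k)$ is a nef-partition: each $\hat\nabla_i$ is a lattice polytope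 containing $0$, and $\hat\nabla_0+\dots+\hat\nabla_k$ is reflexive. Moreover $(\hat\nabla_0+\dots+\hat\nabla_k)^*=\tilde\Delta_0\uplus\dots\uplus\tilde\Delta_k$; the equation $\bar f=0$, written in homogeneous coordinates as in 4, is given by a global section of $\mathcal O(D_{\hat\nabla_0})$, and the equation $g_i=0$ by one of $\mathcal O(D_{\hat\nabla_i})$, where $D_Q=\sum_\rho-\min\langle Q,v_\rho\rangle D_\rho$ and global sections of $\mathcal O(D_Q)$ are the linear combinations of the monomials $\prod_\rho x_\rho^{\langle m,v_\rho\rangle-\min\langle Q,v_\rho\rangle}$ with $m\in Q$ a lattice point. 4. (Homogeneous coordinates.) The primitive generators $v_\rho$ of the rays of the fan of $\bar X$ are the vertices of $\tilde\Delta_0\uplus\dots\uplus\tilde\Delta_k$, each lying in exactly one $\Delta_i+e_i$; those of the fan of $X$ are the vertices of $\Delta$ (the case $k=0$). Write $x^u=\prod_\rho x_\rho^{\langle u,v_\rho\rangle}$, let $B\subset\mathbb C[x_\rho]$ be the irrelevant ideal, generated by the monomials $\prod_{v_\rho\notin\Phi}x_\rho$ for the proper faces $\Phi$ of $\tilde\Delta_0\uplus\dots\uplus\tilde\Delta_k$,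 and let $\operatorname{Spec}\mathbb C[x_\rho]\setminus V(B)\to\bar X$ be the quotient morphism, induced by $$\chi^{\,u+\sum_{j=0}^k\alpha_jr_j^*}\longmapsto x^{\,u+\sum_{j=1}^k\alpha_je_j^*}\prod_{v_\rho\in\Delta_0+e_0}x_\rho^{\alpha_0+\dots+\alpha_k};$$ for $X$ take $k=0$. The subscheme defined by homogeneous polynomials generating an ideal $J$ is the scheme-theoretic image of $V(J)\setminus V(B)$. Then all monomials below have non-negative exponents, the hypersurface $Y\subset X$ is the subscheme given by $$\sum_{n\in\Delta^*\cap N}a_n\,x^n\prod_\rho x_\rho=0,$$ and its image under $\iota$ is the subscheme of $\bar X$ given by $$\sum_{n\in\Delta^*\cap N}a_n\,x^{\,n-\sum_{j=1}^k\min\langle\Delta_j,n\rangle e_j^*}\prod_{v_\rho\in\Delta_0+e_0}x_\rho=0,\qquad \prod_{v_\rho\in\Delta_i+e_i}x_\rho-\prod_{v_\rho\in\Delta_0+e_0}x_\rho=0\quad(i=1,\dots,k).$$ -/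

import Mathlib

open scoped Pointwise
open AlgebraicGeometry CategoryTheory HomogeneousIdeal

noncomputable section

namespace ToricCY

/-! ### Lattice polytopes -/

/-- The inclusion of the lattice `ℤ^ι` into the real vector space `ℝ^ι`.  The lattice `ℤ^ι` is its
own dual lattice, the pairing being the dot product. -/
def toReal {ι : Type} (n : ι → ℤ) : ι → ℝ := fun i => (n i : ℝ)

/-- Lattice polytopes: convex hulls of finite non-empty sets of lattice points. -/
def IsLatticePolytope {ι : Type} (P : Set (ι → ℝ)) : Prop :=
  ∃ s : Finset (ι → ℤ), s.Nonempty ∧ P = convexHull ℝ (toReal '' (s : Set (ι → ℤ)))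

/-- The dual polytope `P^* = {n | ⟨m, n⟩ ≥ -1 for all m ∈ P}`. -/
def polar {ι : Type} [Fintype ι] (P : Set (ι → ℝ)) : Set (ι → ℝ) :=
  {n | ∀ m ∈ P, -1 ≤ m ⬝ᵥ n}

/-- Reflexive polytopes. -/
structure IsReflexive {ι : Type} [Fintype ι] (P : Set (ι → ℝ)) : Prop where
  isLatticePolytope : IsLatticePolytope P
  zero_mem_interior : 0 ∈ interior P
  isLatticePolytope_polar : IsLatticePolytope (polar P)

/-- `min ⟨P, u⟩`. -/
def minPairing {ι : Type} [Fintype ι] (P : Set (ι → ℝ)) (u : ι → ℝ) : ℝ :=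
  sInf ((fun m => m ⬝ᵥ u) '' P)

/-- `min ⟨P, n⟩` as an integer, for a lattice polytope `P` and a lattice point `n`; see
`isLeast_latMin`. -/
def latMin {ι : Type} [Fintype ι] (P : Set (ι → ℝ)) (n : ι → ℤ) : ℤ :=
  ⌊minPairing P (toReal n)⌋

theorem toReal_dotProduct {ι : Type} [Fintype ι] (m n : ι → ℤ) :
    toReal m ⬝ᵥ toReal n = ((m ⬝ᵥ n : ℤ) : ℝ) := by
  simp [toReal, dotProduct]

theorem toReal_injective {ι : Type} : Function.Injective (toReal (ι := ι)) := by
  intro a b h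
  funext i
  have := congrFun h i
  simpa [toReal] using this

theorem isLeast_latMin {ι : Type} [Fintype ι] {P : Set (ι → ℝ)} (hP : IsLatticePolytope P)
    (n : ι → ℤ) : IsLeast ((fun m => m ⬝ᵥ toReal n) '' P) (latMin P n : ℝ) := by
  obtain ⟨s, hs, rfl⟩ := hP
  obtain ⟨m₀, hm₀, hmin⟩ := s.exists_min_image (fun m => m ⬝ᵥ n) hs
  have key : IsLeast ((fun m => m ⬝ᵥ toReal n) '' convexHull ℝ (toReal '' (s : Set (ι → ℤ))))
      ((m₀ ⬝ᵥ n : ℤ) : ℝ) := by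
    refine ⟨⟨toReal m₀, subset_convexHull ℝ _ ⟨m₀, hm₀, rfl⟩, toReal_dotProduct _ _⟩, ?_⟩
    rintro _ ⟨x, hx, rfl⟩
    have hsub : convexHull ℝ (toReal '' (s : Set (ι → ℤ))) ⊆
        {x | ((m₀ ⬝ᵥ n : ℤ) : ℝ) ≤ x ⬝ᵥ toReal n} := by
      refine convexHull_min ?_ ?_
      · rintro _ ⟨m, hm, rfl⟩
        simp only [Set.mem_ofPred_eq, toReal_dotProduct]
        exact_mod_cast hmin m hm
      · exact convex_halfSpace_ge ⟨fun x y => add_dotProduct x y _,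
          fun c x => smul_dotProduct c x _⟩ _
    exact hsub hx
  have h2 : latMin (convexHull ℝ (toReal '' (s : Set (ι → ℤ)))) n = m₀ ⬝ᵥ n := by
    rw [latMin, minPairing, key.csInf_eq, Int.floor_intCast]
  rw [h2]
  exact key

theorem IsLatticePolytope.isBounded {ι : Type} [Fintype ι] {P : Set (ι → ℝ)}
    (hP : IsLatticePolytope P) : Bornology.IsBounded P := by
  obtain ⟨s, -, rfl⟩ := hP
  exact isBounded_convexHull.2 ((s.finite_toSet.image _).isBounded)

theorem finite_latticePoints {ι : Type} [Fintype ι] {P : Set (ι → ℝ)}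
    (hP : Bornology.IsBounded P) : {n : ι → ℤ | toReal n ∈ P}.Finite := by
  obtain ⟨R, hR⟩ := hP.exists_norm_le
  refine (Set.Finite.pi (fun _ : ι => Set.finite_Icc (-⌈R⌉) ⌈R⌉)).subset ?_
  intro n hn i _
  have h1 : |(n i : ℝ)| ≤ R := (norm_le_pi_norm (toReal n) i).trans (hR _ hn)
  have h2 := abs_le.1 (h1.trans (Int.le_ceil R))
  exact ⟨by exact_mod_cast h2.1, by exact_mod_cast h2.2⟩

/-! ### Cayley cones and their semigroup rings -/

/-- The Cayley cone `{(∑ tᵢ Pᵢ, t) | tᵢ ≥ 0}` in `ℝ^ι ⊕ ℝ^κ`. -/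
def cayleyCone {ι κ : Type} [Fintype κ] (P : κ → Set (ι → ℝ)) : Set (ι ⊕ κ → ℝ) :=
  {x | ∃ (t : κ → ℝ) (m : κ → ι → ℝ), (∀ i, 0 ≤ t i) ∧ (∀ i, m i ∈ P i) ∧
    x = Sum.elim (∑ i, t i • m i) t}

/-- The dual cone. -/
def dualCone {ι : Type} [Fintype ι] (C : Set (ι → ℝ)) : Set (ι → ℝ) :=
  {y | ∀ x ∈ C, 0 ≤ x ⬝ᵥ y}

/-- The semigroup of the lattice points of the dual cone. -/
def dualMonoid {ι : Type} [Fintype ι] (C : Set (ι → ℝ)) : AddSubmonoid (ι → ℤ) where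
  carrier := {n | toReal n ∈ dualCone C}
  zero_mem' := by
    intro x _
    simp [toReal, dotProduct]
  add_mem' := by
    intro a b ha hb x hx
    have : toReal (a + b) = toReal a + toReal b := by
      funext i
      simp [toReal]
    rw [this, dotProduct_add]
    exact add_nonneg (ha x hx) (hb x hx)

theorem mem_dualMonoid_cayleyCone {ι κ : Type} [Fintype ι] [Fintype κ] {P : κ → Set (ι → ℝ)}
    (hP : ∀ i, (P i).Nonempty) (n : ι ⊕ κ → ℤ) :
    n ∈ dualMonoid (cayleyCone P) ↔
      ∀ i, ∀ m ∈ P i, 0 ≤ m ⬝ᵥ toReal (n ∘ Sum.inl) + n (Sum.inr i) := by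
  classical
  constructor
  · intro h i m hm
    choose p hp using hP
    have := h (Sum.elim m (Pi.single i 1)) ⟨Pi.single i 1, Function.update p i m, ?_, ?_, ?_⟩
    · simpa [dotProduct, toReal, Pi.single_apply] using this
    · intro j
      by_cases hj : j = i
      · subst hj; simp
      · simp [hj]
    · intro j
      by_cases hj : j = i
      · subst hj; simpa using hm
      · simpa [hj] using hp j
    · congr 1
      rw [Finset.sum_eq_single i]
      · simp
      · intro j _ hj
        simp [hj]
      · simp
  · rintro h _ ⟨t, m, ht, hm, rfl⟩
    have e : Sum.elim (∑ i, t i • m i) t ⬝ᵥ toReal n =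
        ∑ i, t i * (m i ⬝ᵥ toReal (n ∘ Sum.inl) + n (Sum.inr i)) := by
      have : toReal n = Sum.elim (toReal (n ∘ Sum.inl)) (toReal (n ∘ Sum.inr)) := by
        funext j
        cases j <;> rfl
      rw [this, sumElim_dotProduct_sumElim, sum_dotProduct]
      simp only [mul_add, Finset.sum_add_distrib, smul_dotProduct, smul_eq_mul]
      rfl
    rw [e]
    exact Finset.sum_nonneg fun i _ => mul_nonneg (ht i) (h i _ (hm i))

/-- A reflexive polytope `Δ` in `ℝ^d` together with a decomposition `Δ = Δ₀ + ⋯ + Δ_k` as a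
Minkowski sum of lattice polytopes. -/
structure MinkowskiDecomposition (d k : ℕ) where
  part : Fin (k + 1) → Set (Fin d → ℝ)
  isLatticePolytope : ∀ i, IsLatticePolytope (part i)
  isReflexive : IsReflexive (∑ i, part i)

namespace MinkowskiDecomposition

variable {d k : ℕ} (D : MinkowskiDecomposition d k)

/-- The reflexive polytope `Δ = Δ₀ + ⋯ + Δ_k`. -/
def Δ : Set (Fin d → ℝ) := ∑ i, D.part i

/-- The decomposition of `Δ` with the single summand `Δ`. Its Cayley cone is
`σ = {(t Δ, t) | t ≥ 0}` in `ℝ^d ⊕ ℝ`. -/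
def total : MinkowskiDecomposition d 0 where
  part := fun _ => D.Δ
  isLatticePolytope := fun _ => D.isReflexive.isLatticePolytope
  isReflexive := by simpa [Δ] using D.isReflexive

theorem part_nonempty (i : Fin (k + 1)) : (D.part i).Nonempty := by
  obtain ⟨s, ⟨m, hm⟩, h⟩ := D.isLatticePolytope i
  exact ⟨toReal m, h ▸ subset_convexHull ℝ _ ⟨m, hm, rfl⟩⟩

theorem mem_Δ {x : Fin d → ℝ} :
    x ∈ D.Δ ↔ ∃ m : Fin (k + 1) → Fin d → ℝ, (∀ i, m i ∈ D.part i) ∧ ∑ i, m i = x := by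
  simp only [Δ, Set.mem_fintype_sum, exists_prop]

theorem zero_mem_Δ : (0 : Fin d → ℝ) ∈ D.Δ := interior_subset D.isReflexive.zero_mem_interior

/-- The semigroup `σ̄^∨ ∩ (ℤ^d ⊕ ℤ^{k+1})`, where `σ̄` is the Cayley cone of `Δ₀, …, Δ_k`. -/
def monoid : AddSubmonoid (Fin d ⊕ Fin (k + 1) → ℤ) := dualMonoid (cayleyCone D.part)

theorem mem_monoid (n : Fin d ⊕ Fin (k + 1) → ℤ) : n ∈ D.monoid ↔
    ∀ i, ∀ m ∈ D.part i, 0 ≤ m ⬝ᵥ toReal (n ∘ Sum.inl) + n (Sum.inr i) :=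
  mem_dualMonoid_cayleyCone D.part_nonempty n

theorem degree_nonneg (n : D.monoid) : 0 ≤ ∑ i, n.1 (Sum.inr i) := by
  obtain ⟨m, hm, hsum⟩ := D.mem_Δ.1 D.zero_mem_Δ
  have h := fun i => (D.mem_monoid n.1).1 n.2 i (m i) (hm i)
  have h2 := Finset.sum_nonneg fun i (_ : i ∈ Finset.univ) => h i
  rw [Finset.sum_add_distrib, ← sum_dotProduct, hsum, zero_dotProduct, zero_add] at h2
  exact_mod_cast h2

/-- The degree `(n, α₀, …, α_k) ↦ α₀ + ⋯ + α_k`, which is non-negative on the semigroup. -/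
def deg : D.monoid →+ ℕ where
  toFun n := (∑ i, n.1 (Sum.inr i)).toNat
  map_zero' := by simp
  map_add' a b := by
    rw [← Int.toNat_add (D.degree_nonneg a) (D.degree_nonneg b), ← Finset.sum_add_distrib]
    rfl

/-- The semigroup ring `ℂ[σ̄^∨ ∩ (ℤ^d ⊕ ℤ^{k+1})]`. -/
abbrev Ring : Type := AddMonoidAlgebra ℂ D.monoid

/-- The monomial `χ^u`. -/
def chi (u : D.monoid) : D.Ring := AddMonoidAlgebra.single u 1

/-- The grading of the semigroup ring by the degree. -/
abbrev grading : ℕ → Submodule ℂ D.Ring := AddMonoidAlgebra.gradeBy ℂ D.deg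

/-- The projective toric variety `Proj ℂ[σ̄^∨ ∩ (ℤ^d ⊕ ℤ^{k+1})]`. -/
abbrev X : Scheme := Proj D.grading

theorem chi_mem (u : D.monoid) : D.chi u ∈ D.grading (D.deg u) :=
  AddMonoidAlgebra.single_mem_gradeBy _ _ _

/-- The projection of semigroups induced by
`(n, α₀, …, α_k) ↦ (n, α₀ + ⋯ + α_k)`. -/
def monoidProj : D.monoid →+ D.total.monoid where
  toFun u := ⟨Sum.elim (u.1 ∘ Sum.inl) (fun _ => ∑ i, u.1 (Sum.inr i)), by
    rw [mem_monoid]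
    intro i m hm
    obtain ⟨p, hp, rfl⟩ := D.mem_Δ.1 hm
    have h := Finset.sum_nonneg fun i (_ : i ∈ Finset.univ) =>
      (D.mem_monoid u.1).1 u.2 i (p i) (hp i)
    rw [Finset.sum_add_distrib, ← sum_dotProduct] at h
    simpa using h⟩
  map_zero' := by
    ext j
    cases j <;> simp
  map_add' a b := by
    ext j
    cases j <;> simp [Finset.sum_add_distrib]

/-- The induced graded homomorphism
`ℂ[σ̄^∨ ∩ (ℤ^d ⊕ ℤ^{k+1})] → ℂ[σ^∨ ∩ (ℤ^d ⊕ ℤ)]`. -/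
def ringProj : D.grading →+*ᵍ D.total.grading where
  toRingHom := AddMonoidAlgebra.mapDomainRingHom ℂ D.monoidProj
  map_mem := by
    classical
    intro i x hx u hu
    have hu' : u ∈ (Finsupp.mapDomain D.monoidProj x.coeff).support := hu
    obtain ⟨w, hw, rfl⟩ := Finset.mem_image.1 (Finsupp.mapDomain_support hu')
    rw [← hx w hw]
    simp [deg, monoidProj]

theorem sum_latMin (n : Fin d → ℤ) : ∑ i, latMin (D.part i) n = latMin D.Δ n := by
  have h1 : IsLeast ((fun m => m ⬝ᵥ toReal n) '' D.Δ) ((∑ i, latMin (D.part i) n : ℤ) : ℝ) := by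
    constructor
    · choose m hm hmin using fun i => (isLeast_latMin (D.isLatticePolytope i) n).1
      refine ⟨∑ i, m i, D.mem_Δ.2 ⟨m, hm, rfl⟩, ?_⟩
      simp only [sum_dotProduct, Int.cast_sum]
      exact Finset.sum_congr rfl fun i _ => hmin i
    · rintro _ ⟨x, hx, rfl⟩
      obtain ⟨m, hm, rfl⟩ := D.mem_Δ.1 hx
      simp only [sum_dotProduct, Int.cast_sum]
      exact Finset.sum_le_sum fun i _ =>
        (isLeast_latMin (D.isLatticePolytope i) n).2 ⟨m i, hm i, rfl⟩
  exact_mod_cast h1.unique (isLeast_latMin D.isReflexive.isLatticePolytope n)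

theorem mem_monoid_iff_latMin (n : Fin d ⊕ Fin (k + 1) → ℤ) : n ∈ D.monoid ↔
    ∀ i, -latMin (D.part i) (n ∘ Sum.inl) ≤ n (Sum.inr i) := by
  rw [mem_monoid]
  refine forall_congr' fun i => ?_
  have h := isLeast_latMin (D.isLatticePolytope i) (n ∘ Sum.inl)
  constructor
  · intro H
    obtain ⟨m, hm, e⟩ := h.1
    have h3 := H m hm
    have e' : m ⬝ᵥ toReal (n ∘ Sum.inl) = (latMin (D.part i) (n ∘ Sum.inl) : ℝ) := e
    rw [e'] at h3
    have : (0 : ℤ) ≤ latMin (D.part i) (n ∘ Sum.inl) + n (Sum.inr i) := by exact_mod_cast h3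
    lia
  · intro H m hm
    have h3 : (latMin (D.part i) (n ∘ Sum.inl) : ℝ) ≤ m ⬝ᵥ toReal (n ∘ Sum.inl) :=
      h.2 ⟨m, hm, rfl⟩
    have h4 : (-latMin (D.part i) (n ∘ Sum.inl) : ℝ) ≤ n (Sum.inr i) := by exact_mod_cast H
    linarith

theorem monoidProj_surjective : Function.Surjective D.monoidProj := by
  rintro ⟨v, hv⟩
  have hv0 := (D.total.mem_monoid_iff_latMin v).1 hv 0
  have hv1 : -latMin D.Δ (v ∘ Sum.inl) ≤ v (Sum.inr 0) := hv0
  rw [← D.sum_latMin] at hv1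
  set q : Fin (k + 1) → ℤ := fun i => latMin (D.part i) (v ∘ Sum.inl) with hq
  refine ⟨⟨Sum.elim (v ∘ Sum.inl)
    (fun i => -q i + if i = 0 then v (Sum.inr 0) + ∑ j, q j else 0), ?_⟩, ?_⟩
  · rw [mem_monoid_iff_latMin]
    intro i
    have : -∑ j, q j ≤ v (Sum.inr 0) := hv1
    simp only [Sum.elim_inr, Sum.elim_comp_inl]
    change -q i ≤ _
    split_ifs <;> lia
  · apply Subtype.ext
    funext j
    rcases j with j | j
    · rfl
    · obtain rfl : j = 0 := Fin.fin_one_eq_zero j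
      simp [monoidProj, Finset.sum_add_distrib]

theorem ringProj_surjective : Function.Surjective D.ringProj := by
  intro y
  obtain ⟨z, hz⟩ := Finsupp.mapDomain_surjective (M := ℂ) D.monoidProj_surjective y.coeff
  exact ⟨.ofCoeff z, congrArg AddMonoidAlgebra.ofCoeff hz⟩

end MinkowskiDecomposition

/-- A surjective graded homomorphism maps the irrelevant ideal onto the irrelevant ideal. -/
theorem irrelevant_le_map_of_surjective {A B : Type} [CommRing A] [CommRing B] [Algebra ℂ A]
    [Algebra ℂ B] {𝒜 : ℕ → Submodule ℂ A} {ℬ : ℕ → Submodule ℂ B} [GradedAlgebra 𝒜]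
    [GradedAlgebra ℬ] (f : 𝒜 →+*ᵍ ℬ) (hf : Function.Surjective f) : ℬ₊ ≤ 𝒜₊.map f := by
  rw [← toIdeal_le_toIdeal_iff, toIdeal_irrelevant_le]
  intro i hi x hx
  obtain ⟨a, rfl⟩ := hf x
  have h : f (DirectSum.decompose 𝒜 a i : A) = f a := by
    rw [f.map_directSumDecompose, DirectSum.decompose_of_mem_same ℬ hx]
  rw [← h]
  refine Ideal.mem_map_of_mem _ ?_
  exact mem_irrelevant_of_mem _ hi (SetLike.coe_mem _)

/-! ### Closed subschemes of `Proj` -/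

section Quotient

variable {A : Type} [CommRing A] [Algebra ℂ A] {𝒜 : ℕ → Submodule ℂ A} [GradedAlgebra 𝒜]
  (I : HomogeneousIdeal 𝒜)

/-- The grading of the quotient of a graded ring by a homogeneous ideal. -/
def quotGrading : ℕ → Submodule ℂ (A ⧸ I.toIdeal) :=
  fun i => (𝒜 i).map (Ideal.Quotient.mkₐ ℂ I.toIdeal).toLinearMap

theorem mk_mem_quotGrading {i : ℕ} {x : A} (hx : x ∈ 𝒜 i) :
    Ideal.Quotient.mk I.toIdeal x ∈ quotGrading I i := ⟨x, hx, rfl⟩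

/-- The decomposition of a class into the classes of the homogeneous components. -/
def quotDecompose : A ⧸ I.toIdeal →+ DirectSum ℕ fun i => quotGrading I i :=
  QuotientAddGroup.lift _
    ((DirectSum.map fun i => (⟨⟨fun x => ⟨_, mk_mem_quotGrading I x.2⟩, by ext; simp⟩,
      fun x y => by ext; simp⟩ : 𝒜 i →+ quotGrading I i)).comp
      (DirectSum.decomposeAddEquiv 𝒜).toAddMonoidHom) <| by
    intro x hx
    ext i
    simpa [DirectSum.map_apply] using Ideal.Quotient.eq_zero_iff_mem.2 (I.isHomogeneous i hx)

theorem quotDecompose_mk {i : ℕ} {x : A} (hx : x ∈ 𝒜 i) :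
    quotDecompose I (Ideal.Quotient.mk _ x) =
      DirectSum.of (fun i => quotGrading I i) i ⟨_, mk_mem_quotGrading I hx⟩ := by
  change DirectSum.map _ (DirectSum.decompose 𝒜 x) = _
  rw [DirectSum.decompose_of_mem 𝒜 hx, DirectSum.map_of]
  rfl

instance : GradedAlgebra (quotGrading I) where
  one_mem := mk_mem_quotGrading I (SetLike.GradedOne.one_mem (A := 𝒜))
  mul_mem := by
    rintro i j _ _ ⟨x, hx, rfl⟩ ⟨y, hy, rfl⟩
    exact ⟨x * y, SetLike.GradedMul.mul_mem hx hy, map_mul (Ideal.Quotient.mk _) _ _⟩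
  toDecomposition := .ofAddHom _ (quotDecompose I)
    (by
      ext y
      obtain ⟨x, rfl⟩ := Ideal.Quotient.mk_surjective y
      induction x using DirectSum.Decomposition.inductionOn 𝒜 with
      | zero => simp
      | homogeneous m =>
        simp [quotDecompose_mk I m.2]
      | add a b ha hb => simpa [map_add] using congrArg₂ (· + ·) ha hb)
    (by
      ext i ⟨_, x, hx, rfl⟩ : 2
      simp only [AddMonoidHom.comp_apply, DirectSum.coeAddMonoidHom_of]
      exact quotDecompose_mk I hx)

/-- The quotient map of graded rings. -/
def quotMap : 𝒜 →+*ᵍ quotGrading I where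
  toRingHom := Ideal.Quotient.mk I.toIdeal
  map_mem := mk_mem_quotGrading I

/-- The closed subscheme `Proj (A / I)` of `Proj A` cut out by a homogeneous ideal `I`. -/
def closedSubscheme : Scheme := Proj (quotGrading I)

/-- The inclusion `Proj (A / I) → Proj A`. -/
def closedSubschemeι : closedSubscheme I ⟶ Proj 𝒜 :=
  Proj.map (quotMap I) (irrelevant_le_map_of_surjective _ Ideal.Quotient.mk_surjective)

end Quotient

namespace MinkowskiDecomposition

variable {d k : ℕ} (D : MinkowskiDecomposition d k)

/-- The morphism `Proj ℂ[σ^∨ ∩ (ℤ^d ⊕ ℤ)] → Proj ℂ[σ̄^∨ ∩ (ℤ^d ⊕ ℤ^{k+1})]` of projective toric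
varieties. -/
def embedding : D.total.X ⟶ D.X :=
  Proj.map D.ringProj (irrelevant_le_map_of_surjective _ D.ringProj_surjective)

/-! ### The hypersurface and the complete intersection -/

/-- The lattice points `n` of `Δ^*`. -/
abbrev DualPoint : Type := {n : Fin d → ℤ // toReal n ∈ polar D.Δ}

instance : Fintype D.DualPoint :=
  (finite_latticePoints D.isReflexive.isLatticePolytope_polar.isBounded).fintype

instance : Zero D.DualPoint := ⟨0, fun m _ => by simp [toReal, dotProduct]⟩

theorem exists_dotProduct_neg {u : Fin d → ℝ} (hu : u ≠ 0) : ∃ x ∈ D.Δ, x ⬝ᵥ u < 0 := by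
  have h1 : D.Δ ∈ nhds (0 : Fin d → ℝ) := mem_interior_iff_mem_nhds.1 D.isReflexive.zero_mem_interior
  have h2 : Filter.Tendsto (fun t : ℝ => -t • u) (nhdsWithin 0 (Set.Ioi 0)) (nhds 0) := by
    have : Continuous fun t : ℝ => -t • u := by fun_prop
    simpa using (this.tendsto 0).mono_left nhdsWithin_le_nhds
  obtain ⟨t, ht, ht0⟩ := ((h2.eventually h1).and self_mem_nhdsWithin).exists
  refine ⟨_, ht, ?_⟩
  have h3 : 0 < u ⬝ᵥ u := by
    obtain ⟨i, hi⟩ := Function.ne_iff.1 hu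
    exact Finset.sum_pos' (fun j _ => mul_self_nonneg _)
      ⟨i, Finset.mem_univ _, mul_self_pos.2 hi⟩
  rw [smul_dotProduct, smul_eq_mul]
  have : (0 : ℝ) < t := ht0
  nlinarith

theorem latMin_Δ (n : D.DualPoint) (hn : n ≠ 0) : latMin D.Δ n.1 = -1 := by
  have h := isLeast_latMin D.isReflexive.isLatticePolytope n.1
  have h0 : toReal n.1 ≠ 0 := by
    intro h0
    refine hn (Subtype.ext (toReal_injective (h0.trans ?_)))
    funext i
    exact (Int.cast_zero (R := ℝ)).symm
  obtain ⟨x, hx, hx0⟩ := D.exists_dotProduct_neg h0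
  have h1 : (latMin D.Δ n.1 : ℝ) < 0 := (h.2 ⟨x, hx, rfl⟩).trans_lt hx0
  obtain ⟨y, hy, hy'⟩ := h.1
  have h2 : (-1 : ℝ) ≤ latMin D.Δ n.1 := hy' ▸ n.2 y hy
  have h1' : latMin D.Δ n.1 < 0 := by exact_mod_cast h1
  have h2' : -1 ≤ latMin D.Δ n.1 := by exact_mod_cast h2
  lia

/-- `(n, 1)`. -/
def levelOne (n : D.DualPoint) : D.total.monoid :=
  ⟨Sum.elim n.1 fun _ => 1, by
    rw [mem_monoid]
    intro i m hm
    have := n.2 m hm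
    simp
    linarith⟩

/-- `n - ∑ⱼ min ⟨Δⱼ, n⟩ rⱼ^*`. -/
def lift (n : Fin d → ℤ) : D.monoid :=
  ⟨Sum.elim n fun j => -latMin (D.part j) n, by
    rw [mem_monoid_iff_latMin]
    intro i
    simp⟩

/-- `rᵢ^*`. -/
def r (i : Fin (k + 1)) : D.monoid :=
  ⟨Sum.elim 0 fun j => if j = i then 1 else 0, by
    rw [mem_monoid]
    intro j m hm
    by_cases h : j = i
    · subst h; simp [toReal, dotProduct]
    · simp [toReal, dotProduct, h]⟩

/-- `f = ∑_{n ∈ Δ^* ∩ ℤ^d} aₙ χ^{(n, 1)}`. -/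
def f (a : D.DualPoint → ℂ) : D.total.Ring := ∑ n, a n • D.total.chi (D.levelOne n)

open Classical in
/-- `a₀ χ^{r₀^*} + ∑_{n ≠ 0} aₙ χ^{n - ∑ⱼ min ⟨Δⱼ, n⟩ rⱼ^*}`. -/
def fBar (a : D.DualPoint → ℂ) : D.Ring :=
  a 0 • D.chi (D.r 0) + ∑ n with n ≠ 0, a n • D.chi (D.lift n)

/-- `χ^{rᵢ^*} - χ^{r₀^*}` for `i = 1, …, k`. -/
def g (i : Fin k) : D.Ring := D.chi (D.r i.succ) - D.chi (D.r 0)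

theorem f_mem (a : D.DualPoint → ℂ) : D.f a ∈ D.total.grading 1 := by
  refine Submodule.sum_mem _ fun n _ => Submodule.smul_mem _ _ ?_
  have h : D.total.deg (D.levelOne n) = 1 := by simp [deg, levelOne]
  simpa only [h] using D.total.chi_mem (D.levelOne n)

theorem chi_r_mem (i : Fin (k + 1)) : D.chi (D.r i) ∈ D.grading 1 := by
  have h : D.deg (D.r i) = 1 := by simp [deg, r]
  simpa only [h] using D.chi_mem (D.r i)

theorem g_mem (i : Fin k) : D.g i ∈ D.grading 1 :=
  Submodule.sub_mem _ (D.chi_r_mem _) (D.chi_r_mem _)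

theorem fBar_mem (a : D.DualPoint → ℂ) : D.fBar a ∈ D.grading 1 := by
  refine Submodule.add_mem _ (Submodule.smul_mem _ _ (D.chi_r_mem 0))
    (Submodule.sum_mem _ fun n hn => Submodule.smul_mem _ _ ?_)
  have h : D.deg (D.lift n) = 1 := by
    simp [deg, lift, D.sum_latMin, D.latMin_Δ n (by simpa using hn)]
  simpa only [h] using D.chi_mem (D.lift n)

/-- The homogeneous ideal `(f)`. -/
def idealY (a : D.DualPoint → ℂ) : HomogeneousIdeal D.total.grading :=
  ⟨Ideal.span {D.f a}, Ideal.homogeneous_span _ _ <| by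
    rintro _ rfl
    exact ⟨1, D.f_mem a⟩⟩

/-- The homogeneous ideal generated by `a₀ χ^{r₀^*} + ∑_{n ≠ 0} aₙ χ^{n - ∑ⱼ min ⟨Δⱼ, n⟩ rⱼ^*}`
and `χ^{rᵢ^*} - χ^{r₀^*}`, `i = 1, …, k`. -/
def idealCI (a : D.DualPoint → ℂ) : HomogeneousIdeal D.grading :=
  ⟨Ideal.span (insert (D.fBar a) (Set.range D.g)), Ideal.homogeneous_span _ _ <| by
    rintro _ (rfl | ⟨i, rfl⟩)
    · exact ⟨1, D.fBar_mem a⟩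
    · exact ⟨1, D.g_mem i⟩⟩

end MinkowskiDecomposition

/-! ### Morphisms to `Proj` -/

theorem glue_aux {A σ : Type} [CommRing A] [SetLike σ A] [AddSubgroupClass σ A] (𝒜 : ℕ → σ)
    [GradedRing 𝒜] {X : Scheme.{0}} (φ : A →+* Γ(X, ⊤)) {s t : A} {m n : ℕ} (hm : 0 < m)
    (hn : 0 < n) (hs : s ∈ 𝒜 m) (ht : t ∈ 𝒜 n) :
    Limits.pullback.fst (X.basicOpen (φ s)).ι (X.basicOpen (φ t)).ι ≫
      Proj.toBasicOpenOfGlobalSections 𝒜 φ rfl hm hs ≫ (Proj.basicOpen 𝒜 s).ι =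
    Limits.pullback.snd (X.basicOpen (φ s)).ι (X.basicOpen (φ t)).ι ≫
      Proj.toBasicOpenOfGlobalSections 𝒜 φ rfl hn ht ≫ (Proj.basicOpen 𝒜 t).ι := by
  have h1 := Proj.homOfLE_toBasicOpenOfGlobalSections_ι 𝒜 φ (H := rfl) (H' := rfl)
    (h0d := hm) (hd := hs) (h0d' := Nat.add_pos_left hm n) (hd' := SetLike.mul_mem_graded hs ht)
    rfl rfl ht
  have h2 := Proj.homOfLE_toBasicOpenOfGlobalSections_ι 𝒜 φ (H := rfl) (H' := rfl)
    (h0d := hn) (hd := ht) (h0d' := Nat.add_pos_left hm n) (hd' := SetLike.mul_mem_graded hs ht)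
    (mul_comm _ _) (add_comm _ _) hs
  have hle : X.basicOpen (φ s) ⊓ X.basicOpen (φ t) = X.basicOpen (φ (s * t)) := by
    rw [map_mul, Scheme.basicOpen_mul]
  let e := (isPullback_opens_inf (X.basicOpen (φ s)) (X.basicOpen (φ t))).isoPullback
  rw [← cancel_epi e.hom, ← cancel_epi (X.isoOfEq hle).inv]
  have e1 : (X.isoOfEq hle).inv ≫ e.hom ≫ Limits.pullback.fst _ _ =
      X.homOfLE (hle.ge.trans inf_le_left) := by
    rw [IsPullback.isoPullback_hom_fst, Scheme.isoOfEq_inv, Scheme.homOfLE_homOfLE]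
  have e2 : (X.isoOfEq hle).inv ≫ e.hom ≫ Limits.pullback.snd _ _ =
      X.homOfLE (hle.ge.trans inf_le_right) := by
    rw [IsPullback.isoPullback_hom_snd, Scheme.isoOfEq_inv, Scheme.homOfLE_homOfLE]
  rw [reassoc_of% e1, reassoc_of% e2, h1, h2]

/-- If the open sets `D(φ(s))`, for `s` homogeneous of positive degree, cover `X`, then
`φ : A → Γ(X, ⊤)` induces a morphism `X → Proj A`: it maps `D(φ(s))` to `D₊(s) = Spec A_(s)` by
the ring homomorphism `A_(s) → Γ(X, ⊤)_{φ(s)}`. -/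
def toProj {A σ : Type} [CommRing A] [SetLike σ A] [AddSubgroupClass σ A] (𝒜 : ℕ → σ)
    [GradedRing 𝒜] {X : Scheme.{0}} (φ : A →+* Γ(X, ⊤)) (hφ : TopologicalSpace.IsOpenCover
    (fun ir : Σ' i r, 0 < i ∧ r ∈ 𝒜 i => X.basicOpen (φ ir.2.1))) : X ⟶ Proj 𝒜 :=
  (X.openCoverOfIsOpenCover _ hφ).glueMorphisms
    (fun ri => Proj.toBasicOpenOfGlobalSections 𝒜 φ rfl ri.2.2.1 ri.2.2.2 ≫ Scheme.Opens.ι _)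
    fun x y => glue_aux 𝒜 φ x.2.2.1 y.2.2.1 x.2.2.2 y.2.2.2


/-! ### Homogeneous coordinates -/

namespace MinkowskiDecomposition

variable {d k : ℕ} (D : MinkowskiDecomposition d k)

/-- The vectors `e₀ = -(e₁ + ⋯ + e_k), e₁, …, e_k` of `ℤ^d ⊕ ℤ^k`. -/
def eVec : Fin (k + 1) → (Fin d ⊕ Fin k → ℤ) :=
  Fin.cons (α := fun _ => Fin d ⊕ Fin k → ℤ) (Sum.elim 0 fun _ => -1) fun i => Sum.elim 0 fun j => if j = i then 1 else 0

/-- The polytope `Δᵢ + eᵢ` in `ℝ^d ⊕ ℝ^k`. -/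
def shifted (i : Fin (k + 1)) : Set (Fin d ⊕ Fin k → ℝ) :=
  (fun m => (Sum.elim m (0 : Fin k → ℝ) + toReal (eVec i) : Fin d ⊕ Fin k → ℝ)) '' D.part i

/-- The polytope `Δ̃ᵢ = conv(Δᵢ + eᵢ, 0)`. -/
def tildeΔ (i : Fin (k + 1)) : Set (Fin d ⊕ Fin k → ℝ) := convexHull ℝ (insert 0 (D.shifted i))

/-- The polytope `Δ̃₀ ⊎ ⋯ ⊎ Δ̃_k`, the convex hull of the union of the `Δ̃ᵢ`. The cones over its
proper faces form the fan of `X_{(Δ̃₀ ⊎ ⋯ ⊎ Δ̃_k)^*}`. For the decomposition `D.total`, where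
`k = 0`, it is the polytope `Δ` in `ℝ^d ⊕ ℝ^0`. -/
def tilde : Set (Fin d ⊕ Fin k → ℝ) := convexHull ℝ (⋃ i, D.tildeΔ i)

/-- The primitive generators `v_ρ` of the rays of the fan: the vertices of `Δ̃₀ ⊎ ⋯ ⊎ Δ̃_k`.
(The condition `v ≠ 0` only matters for `d = k = 0`, where the fan has no rays.) -/
def Ray : Type := {v : Fin d ⊕ Fin k → ℤ // toReal v ∈ D.tilde.extremePoints ℝ ∧ v ≠ 0}

theorem tilde_eq : D.tilde = convexHull ℝ (insert 0 (⋃ i, D.shifted i)) := by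
  apply subset_antisymm
  · refine convexHull_min (Set.iUnion_subset fun i => convexHull_mono ?_) (convex_convexHull ℝ _)
    exact Set.insert_subset_insert (Set.subset_iUnion _ i)
  · refine convexHull_min (Set.insert_subset ?_ (Set.iUnion_subset fun i => ?_))
      (convex_convexHull ℝ _)
    · exact subset_convexHull ℝ _ (Set.mem_iUnion.2 ⟨0, subset_convexHull ℝ _ (by simp)⟩)
    · intro x hx
      exact subset_convexHull ℝ _ (Set.mem_iUnion.2 ⟨i, subset_convexHull ℝ _ (by simp [hx])⟩)

theorem exists_mem_shifted (v : D.Ray) : ∃ i, toReal v.1 ∈ D.shifted i := by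
  have h : toReal v.1 ∈ (convexHull ℝ (insert 0 (⋃ i, D.shifted i))).extremePoints ℝ :=
    D.tilde_eq ▸ v.2.1
  rcases extremePoints_convexHull_subset h with h | h
  · refine absurd (toReal_injective (h.trans ?_)) v.2.2
    funext i
    exact (Int.cast_zero (R := ℝ)).symm
  · exact Set.mem_iUnion.1 h

theorem tilde_isBounded : Bornology.IsBounded D.tilde := by
  rw [tilde_eq, isBounded_convexHull, Bornology.isBounded_insert, Bornology.isBounded_iUnion]
  intro i
  obtain ⟨R, hR⟩ := (D.isLatticePolytope i).isBounded.exists_norm_le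
  refine isBounded_iff_forall_norm_le.2 ⟨R + ‖toReal (eVec (d := d) i)‖, ?_⟩
  rintro _ ⟨m, hm, rfl⟩
  refine (norm_add_le _ _).trans (add_le_add_left ?_ _)
  have hR0 : 0 ≤ R := (norm_nonneg m).trans (hR m hm)
  refine (pi_norm_le_iff_of_nonneg hR0).2 ?_
  rintro (j | j)
  · exact (norm_le_pi_norm m j).trans (hR m hm)
  · simpa using hR0

instance : Fintype D.Ray :=
  ((finite_latticePoints D.tilde_isBounded).subset
    (fun (v : Fin d ⊕ Fin k → ℤ) (hv : toReal v ∈ D.tilde.extremePoints ℝ ∧ v ≠ 0) =>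
      (extremePoints_subset hv.1 : toReal v ∈ D.tilde))).fintype

/-- The homogeneous coordinate ring `ℂ[x_ρ]`. -/
abbrev CoxRing : Type := MvPolynomial D.Ray ℂ

/-- The monomial `∏ x_ρ ^ e_ρ`. It is only used for exponents `e_ρ ≥ 0`. -/
def coxMonomial (e : D.Ray → ℤ) : D.CoxRing :=
  ∏ v, MvPolynomial.X v ^ (e v).toNat

open Classical in
/-- The divisor `∑ D_ρ`, the sum being over all `v_ρ ∈ Δᵢ + eᵢ`. -/
def divisor (i : Fin (k + 1)) (v : D.Ray) : ℤ := if toReal v.1 ∈ D.shifted i then 1 else 0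

/-- The exponents of the monomial `x^{u + ∑_{j ≥ 1} αⱼ eⱼ^*} ∏_{v_ρ ∈ Δ₀ + e₀} x_ρ^{α₀ + ⋯ + α_k}`
which corresponds to the element `u + ∑ⱼ αⱼ rⱼ^*` of the semigroup. -/
def coxExp (u : Fin d ⊕ Fin (k + 1) → ℤ) (v : D.Ray) : ℤ :=
  v.1 ⬝ᵥ Sum.elim (u ∘ Sum.inl) (fun j => u (Sum.inr j.succ)) +
    (∑ i, u (Sum.inr i)) * D.divisor 0 v

theorem coxExp_eq (u : Fin d ⊕ Fin (k + 1) → ℤ) (v : D.Ray) {i : Fin (k + 1)}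
    {m : Fin d → ℝ} (h : Sum.elim m (0 : Fin k → ℝ) + toReal (eVec i) = toReal v.1) (hm : m ∈ D.part i) :
    (D.coxExp u v : ℝ) = m ⬝ᵥ toReal (u ∘ Sum.inl) + u (Sum.inr i) := by
  have h0 : ∀ j, (v.1 (Sum.inl j) : ℝ) = m j + eVec i (Sum.inl j) := fun j =>
    (congrFun h (Sum.inl j)).symm
  have h1 : ∀ j, v.1 (Sum.inr j) = eVec (d := d) i (Sum.inr j) := fun j => by
    have := (congrFun h (Sum.inr j)).symm
    have h2 : (v.1 (Sum.inr j) : ℝ) = 0 + eVec i (Sum.inr j) := this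
    rw [zero_add] at h2
    exact_mod_cast h2
  have h2 : eVec (d := d) (k := k) i ∘ Sum.inl = 0 := by
    funext j
    refine Fin.cases ?_ (fun i => ?_) i <;> rfl
  have h3 : ∀ j, (v.1 (Sum.inl j) : ℝ) = m j := fun j => by
    have := congrFun h2 j
    simp only [Function.comp_apply, Pi.zero_apply] at this
    rw [h0, this, Int.cast_zero, add_zero]
  have h4 : (D.coxExp u v : ℝ) = m ⬝ᵥ toReal (u ∘ Sum.inl) +
      ((∑ j : Fin k, eVec (d := d) i (Sum.inr j) * u (Sum.inr j.succ) +
        (∑ i, u (Sum.inr i)) * D.divisor 0 v : ℤ) : ℝ) := by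
    simp only [coxExp, dotProduct, Fintype.sum_sum_type, Sum.elim_inl, Sum.elim_inr, h1,
      Int.cast_add, Int.cast_sum, Int.cast_mul, h3, toReal, Function.comp_apply]
    ring
  rw [h4]
  congr 2
  rcases Fin.eq_zero_or_eq_succ i with rfl | ⟨i, rfl⟩
  · have : D.divisor 0 v = 1 := if_pos ⟨m, hm, h⟩
    rw [this, Fin.sum_univ_succ]
    simp [eVec]
  · have : D.divisor 0 v = 0 := by
      refine if_neg ?_
      rintro ⟨m', -, h'⟩
      have h5 := congrFun (h'.trans h.symm) (Sum.inr i)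
      simp [eVec, toReal] at h5
      norm_num at h5
    rw [this]
    simp [eVec]

theorem coxExp_nonneg (u : D.monoid) (v : D.Ray) : 0 ≤ D.coxExp u.1 v := by
  obtain ⟨i, m, hm, h⟩ := D.exists_mem_shifted v
  have := (D.mem_monoid u.1).1 u.2 i m hm
  rw [← D.coxExp_eq u.1 v h hm] at this
  exact_mod_cast this

/-- The ring homomorphism `ℂ[σ̄^∨ ∩ (ℤ^d ⊕ ℤ^{k+1})] → ℂ[x_ρ]`,
`χ^{u + ∑ⱼ αⱼ rⱼ^*} ↦ x^{u + ∑_{j ≥ 1} αⱼ eⱼ^*} ∏_{v_ρ ∈ Δ₀ + e₀} x_ρ^{α₀ + ⋯ + α_k}`. -/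
def coxMap : D.Ring →+* D.CoxRing :=
  (AddMonoidAlgebra.lift ℂ D.CoxRing D.monoid
    { toFun := fun u => D.coxMonomial (D.coxExp u.toAdd.1)
      map_one' := by
        simp [coxMonomial, coxExp, dotProduct]
      map_mul' := fun a b => by
        simp only [coxMonomial]
        rw [← Finset.prod_mul_distrib]
        refine Finset.prod_congr rfl fun v _ => ?_
        rw [← pow_add, ← Int.toNat_add (D.coxExp_nonneg _ v) (D.coxExp_nonneg _ v)]
        congr 2
        simp only [coxExp, dotProduct, Fintype.sum_sum_type, toAdd_mul, AddSubmonoid.coe_add,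
          Sum.elim_inl, Sum.elim_inr, Function.comp_apply, Pi.add_apply, mul_add, add_mul,
          Finset.sum_add_distrib]
        ring }).toRingHom

open Classical in
/-- The irrelevant ideal, generated by the monomials `∏_{ρ ⊄ σ} x_ρ` for the cones `σ` of the fan,
that is for the cones over the proper faces `F` of `Δ̃₀ ⊎ ⋯ ⊎ Δ̃_k`. -/
def irrelevantIdeal : Ideal D.CoxRing :=
  Ideal.span {x | ∃ F, IsExposed ℝ D.tilde F ∧ F ≠ D.tilde ∧
    x = ∏ v : D.Ray with toReal v.1 ∉ F, MvPolynomial.X v}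

/-- The open subset `ℂ^{Σ(1)} ∖ V(B)` of affine space. -/
def coxOpen : (Spec (.of D.CoxRing)).Opens :=
  ⟨(PrimeSpectrum.zeroLocus D.irrelevantIdeal)ᶜ,
    (PrimeSpectrum.isClosed_zeroLocus _).isOpen_compl⟩

theorem exists_vanishing {F : Set (Fin d ⊕ Fin k → ℝ)} (hF : IsExposed ℝ D.tilde F)
    (hF' : F ≠ D.tilde) : ∃ u : D.monoid, 0 < D.deg u ∧
      ∀ v : D.Ray, toReal v.1 ∈ F → D.coxExp u.1 v = 0 := by
  classical
  have hdegr : ∀ j, 0 < D.deg (D.r j) := fun j => by simp [deg, r]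
  rcases F.eq_empty_or_nonempty with rfl | hFne
  · exact ⟨D.r 0, hdegr 0, fun v hv => hv.elim⟩
  obtain ⟨l, hl⟩ := hF hFne
  obtain ⟨x₀, hx₀⟩ := hFne
  have hx₀P : x₀ ∈ D.tilde := by rw [hl] at hx₀; exact hx₀.1
  set c : ℝ := l x₀ with hc
  have hle : ∀ y ∈ D.tilde, l y ≤ c := by rw [hl] at hx₀; exact hx₀.2
  have hFmem : ∀ y ∈ D.tilde, (y ∈ F ↔ l y = c) := by
    intro y hy
    constructor
    · intro h
      rw [hl] at h
      exact le_antisymm (hle y hy) (h.2 x₀ hx₀P)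
    · intro h
      rw [hl]
      exact ⟨hy, fun z hz => (hle z hz).trans_eq h.symm⟩
  have hshift : ∀ i, ∀ m ∈ D.part i, (Sum.elim m (0 : Fin k → ℝ) + toReal (eVec i) : Fin d ⊕ Fin k → ℝ) ∈
      D.tilde := by
    intro i m hm
    rw [tilde_eq]
    exact subset_convexHull ℝ _ (Or.inr (Set.mem_iUnion.2 ⟨i, m, hm, rfl⟩))
  have hzero : (0 : Fin d ⊕ Fin k → ℝ) ∈ D.tilde := by
    rw [tilde_eq]
    exact subset_convexHull ℝ _ (Or.inl rfl)
  have hc0 : 0 ≤ c := by simpa using hle 0 hzero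
  -- the linear form in coordinates
  set n : Fin d → ℝ := fun j => -l (Pi.single (Sum.inl j) 1) with hn
  have hln : ∀ m : Fin d → ℝ, l (Sum.elim m (0 : Fin k → ℝ)) = -(m ⬝ᵥ n) := by
    intro m
    have : (Sum.elim m (0 : Fin k → ℝ) : Fin d ⊕ Fin k → ℝ) =
        ∑ j, m j • (Pi.single (Sum.inl j) 1 : Fin d ⊕ Fin k → ℝ) := by
      funext q
      rcases q with q | q
      · simp [Finset.sum_apply, Pi.single_apply]
      · simp [Finset.sum_apply]
    rw [this, map_sum]
    simp [dotProduct, hn]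
  set α : Fin (k + 1) → ℝ := fun i => c - l (toReal (eVec i)) with hα
  have hmα : ∀ i, ∀ m ∈ D.part i, 0 ≤ m ⬝ᵥ n + α i := by
    intro i m hm
    have := hle _ (hshift i m hm)
    rw [map_add, hln] at this
    simp only [hα]
    linarith
  have hmF : ∀ i, ∀ m ∈ D.part i,
      (Sum.elim m (0 : Fin k → ℝ) + toReal (eVec i) : Fin d ⊕ Fin k → ℝ) ∈ F → m ⬝ᵥ n = -α i := by
    intro i m hm h
    have := (hFmem _ (hshift i m hm)).1 h
    rw [map_add, hln] at this
    simp only [hα]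
    linarith
  by_cases hn0 : n = 0
  · have hα0 : ∀ i, 0 ≤ α i := by
      intro i
      obtain ⟨m, hm⟩ := D.part_nonempty i
      simpa [hn0] using hmα i m hm
    have hsum : ∑ i, α i = (k + 1) * c := by
      have : ∑ i, toReal (eVec (d := d) (k := k) i) = 0 := by
        funext q
        rcases q with q | q
        · simp [Fin.sum_univ_succ, eVec, toReal, Finset.sum_apply]
        · simp [Fin.sum_univ_succ, eVec, toReal, Finset.sum_apply]
      simp only [hα, Finset.sum_sub_distrib, ← map_sum, this]
      simp
    have hex : ∃ j, 0 < α j := by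
      by_contra! hno
      have hz : ∀ i, α i = 0 := fun i => le_antisymm (hno i) (hα0 i)
      have hcz : c = 0 := by
        have h1 : (0 : ℝ) = (k + 1) * c := by rw [← hsum]; simp [hz]
        have h2 : (0 : ℝ) < k + 1 := by positivity
        nlinarith
      refine hF' (subset_antisymm (by rw [hl]; exact fun y hy => hy.1) fun y hy => ?_)
      refine (hFmem y hy).2 ?_
      have hconv : D.tilde ⊆ {y | l y = 0} := by
        rw [tilde_eq]
        refine convexHull_min ?_ (convex_hyperplane l.toLinearMap.isLinear 0)
        refine Set.insert_subset (map_zero l) (Set.iUnion_subset fun i => ?_)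
        rintro _ ⟨m, hm, rfl⟩
        have h1 : l (toReal (eVec i)) = 0 := by
          have := hz i
          simp only [hα, hcz] at this
          linarith
        change l _ = 0
        rw [map_add, hln, h1, hn0]
        simp
      rw [hcz]
      exact hconv hy
    obtain ⟨j, hj⟩ := hex
    refine ⟨D.r j, hdegr j, fun v hv => ?_⟩
    obtain ⟨i, m, hm, h⟩ := D.exists_mem_shifted v
    have h1 : α i = 0 := by
      have := hmF i m hm (Set.mem_of_eq_of_mem h hv)
      rw [hn0, dotProduct_zero] at this
      linarith
    have hij : i ≠ j := by
      rintro rfl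
      linarith
    have h11 : (D.coxExp (D.r j).1 v : ℝ) = 0 := by
      rw [D.coxExp_eq (D.r j).1 v h hm]
      simp [r, hij, toReal, dotProduct]
    exact_mod_cast h11
  · -- minimizers
    have hmin : ∀ i, ∃ m ∈ D.part i, ∀ y ∈ D.part i, m ⬝ᵥ n ≤ y ⬝ᵥ n := by
      intro i
      obtain ⟨s, hs, hP⟩ := D.isLatticePolytope i
      have hcomp : IsCompact (D.part i) := by
        rw [hP]
        exact (s.finite_toSet.image _).isCompact_convexHull ℝ
      exact hcomp.exists_isMinOn (D.part_nonempty i) 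
        (Continuous.continuousOn (f := fun m => m ⬝ᵥ n) (by unfold dotProduct; fun_prop))
    choose p hp hpmin using hmin
    obtain ⟨x, hx, hxn⟩ := D.exists_dotProduct_neg hn0
    set A : ℝ := -∑ i, p i ⬝ᵥ n with hA
    have hΔA : ∀ x ∈ D.Δ, -A ≤ x ⬝ᵥ n := by
      intro x hx
      obtain ⟨m, hm, rfl⟩ := D.mem_Δ.1 hx
      rw [hA, neg_neg, sum_dotProduct]
      exact Finset.sum_le_sum fun i _ => hpmin i _ (hm i)
    have hA0 : 0 < A := by linarith [hΔA x hx]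
    have hpolar : A⁻¹ • n ∈ polar D.Δ := by
      intro x hx
      have h1 := hΔA x hx
      rw [dotProduct_smul, smul_eq_mul]
      calc (-1 : ℝ) = A⁻¹ * (-A) := by field_simp
        _ ≤ A⁻¹ * (x ⬝ᵥ n) := mul_le_mul_of_nonneg_left h1 (by positivity)
    obtain ⟨s, hs, hP⟩ := D.isReflexive.isLatticePolytope_polar
    have hP' : polar D.Δ = convexHull ℝ ((s.image toReal : Finset (Fin d → ℝ)) : Set _) := by
      rw [Finset.coe_image]; exact hP
    rw [hP', Finset.mem_convexHull'] at hpolar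
    obtain ⟨w, hw0, hw1, hw2⟩ := hpolar
    obtain ⟨y, hy, hwy⟩ : ∃ y ∈ s.image toReal, 0 < w y := by
      by_contra! hno
      have : ∑ y ∈ s.image toReal, w y ≤ 0 := Finset.sum_nonpos hno
      linarith
    have hkey : ∀ m : Fin (k + 1) → Fin d → ℝ, (∀ i, m i ∈ D.part i) →
        (∀ i, m i ⬝ᵥ n = p i ⬝ᵥ n) → (∑ i, m i) ⬝ᵥ y = -1 := by
      intro m hm hmp
      set x := ∑ i, m i with hx
      have hxΔ : x ∈ D.Δ := D.mem_Δ.2 ⟨m, hm, rfl⟩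
      have h1 : ∀ z ∈ s.image toReal, -1 ≤ x ⬝ᵥ z := by
        intro z hz
        have : z ∈ polar D.Δ := by rw [hP']; exact subset_convexHull ℝ _ hz
        exact this x hxΔ
      have h2 : x ⬝ᵥ (A⁻¹ • n) = -1 := by
        rw [dotProduct_smul, smul_eq_mul, hx, sum_dotProduct,
          Finset.sum_congr rfl fun i _ => hmp i]
        have : ∑ i, p i ⬝ᵥ n = -A := by rw [hA, neg_neg]
        rw [this]
        field_simp
      have h3 : ∑ z ∈ s.image toReal, w z * (x ⬝ᵥ z + 1) = 0 := by
        have : x ⬝ᵥ (∑ z ∈ s.image toReal, w z • z) = -1 := by rw [hw2]; exact h2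
        rw [dotProduct_sum] at this
        simp only [dotProduct_smul, smul_eq_mul] at this
        simp only [mul_add, mul_one, Finset.sum_add_distrib, hw1]
        linarith
      have h4 := (Finset.sum_eq_zero_iff_of_nonneg fun z hz =>
        mul_nonneg (hw0 z hz) (by linarith [h1 z hz])).1 h3 y hy
      rcases mul_eq_zero.1 h4 with h5 | h5
      · linarith
      · linarith
    obtain ⟨y, hys, rfl⟩ := Finset.mem_image.1 hy
    have hyΔ : ∀ x ∈ D.Δ, -1 ≤ x ⬝ᵥ toReal y := by
      have : toReal y ∈ polar D.Δ := by rw [hP']; exact subset_convexHull ℝ _ hy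
      exact this
    have hylat : latMin D.Δ y = -1 := by
      have h1 := isLeast_latMin D.isReflexive.isLatticePolytope y
      have h2 : IsLeast ((fun m => m ⬝ᵥ toReal y) '' D.Δ) (-1 : ℝ) :=
        ⟨⟨_, D.mem_Δ.2 ⟨p, hp, rfl⟩, hkey p hp fun _ => rfl⟩, by
          rintro _ ⟨x, hx, rfl⟩
          exact hyΔ x hx⟩
      exact_mod_cast h1.unique h2
    refine ⟨D.lift y, by simp [deg, lift, D.sum_latMin, hylat], fun v hv => ?_⟩
    obtain ⟨i, m, hm, h⟩ := D.exists_mem_shifted v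
    have hmn : m ⬝ᵥ n = p i ⬝ᵥ n := by
      refine le_antisymm ?_ (hpmin i m hm)
      rw [hmF i m hm (Set.mem_of_eq_of_mem h hv)]
      linarith [hmα i (p i) (hp i)]
    set q : Fin (k + 1) → Fin d → ℝ := Function.update p i m with hq
    have hqm : ∀ j, q j ∈ D.part j := by
      intro j
      by_cases hj : j = i
      · subst hj; simpa [hq] using hm
      · simpa [hq, hj] using hp j
    have hqn : ∀ j, q j ⬝ᵥ n = p j ⬝ᵥ n := by
      intro j
      by_cases hj : j = i
      · subst hj; simpa [hq] using hmn
      · simp [hq, hj]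
    have h5 := hkey q hqm hqn
    have h6 : ∀ j, (latMin (D.part j) y : ℝ) ≤ q j ⬝ᵥ toReal y := fun j =>
      (isLeast_latMin (D.isLatticePolytope j) y).2 ⟨q j, hqm j, rfl⟩
    have h7 : ∑ j, (latMin (D.part j) y : ℝ) = -1 := by
      have := D.sum_latMin y
      rw [hylat] at this
      exact_mod_cast this
    have h8 : ∑ j, (q j ⬝ᵥ toReal y - latMin (D.part j) y) = 0 := by
      rw [Finset.sum_sub_distrib, ← sum_dotProduct, h5, h7, sub_self]
    have h9 := (Finset.sum_eq_zero_iff_of_nonneg fun j _ => by linarith [h6 j]).1 h8 i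
      (Finset.mem_univ i)
    have h10 : q i = m := by simp [hq]
    rw [h10] at h9
    have h11 : (D.coxExp (D.lift y).1 v : ℝ) = 0 := by
      rw [D.coxExp_eq (D.lift y).1 v h hm]
      simp only [lift, Sum.elim_comp_inl, Sum.elim_inr, Int.cast_neg]
      linarith
    exact_mod_cast h11

/-- The homomorphism from the semigroup ring to the functions on `ℂ^{Σ(1)} ∖ V(B)`. -/
def coxSections : D.Ring →+* Γ(D.coxOpen.toScheme, ⊤) :=
  (D.coxOpen.ι.appTop.hom.comp (Scheme.ΓSpecIso (.of D.CoxRing)).inv.hom).comp D.coxMap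

theorem coxSections_cover : TopologicalSpace.IsOpenCover
    (fun ir : Σ' i r, 0 < i ∧ r ∈ D.grading i =>
      D.coxOpen.toScheme.basicOpen (D.coxSections ir.2.1)) := by
  classical
  refine top_unique fun x _ => ?_
  have hx : x.1 ∈ D.coxOpen := x.2
  have hx' : ¬ (D.irrelevantIdeal : Set D.CoxRing) ⊆ x.1.asIdeal := hx
  rw [irrelevantIdeal, SetLike.coe_subset_coe, Ideal.span_le, Set.not_subset] at hx'
  obtain ⟨_, ⟨F, hF, hF', rfl⟩, hxF⟩ := hx'
  obtain ⟨u, hu, huF⟩ := D.exists_vanishing hF hF'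
  refine TopologicalSpace.Opens.mem_iSup.2 ⟨⟨D.deg u, D.chi u, hu, D.chi_mem u⟩, ?_⟩
  have h1 : D.coxOpen.toScheme.basicOpen (D.coxSections (D.chi u)) =
      D.coxOpen.ι ⁻¹ᵁ PrimeSpectrum.basicOpen (D.coxMap (D.chi u)) := by
    rw [← basicOpen_eq_of_affine (R := .of D.CoxRing), Scheme.preimage_basicOpen]
    rfl
  have h2 : D.coxMap (D.chi u) ∉ x.1.asIdeal := by
    have h3 : D.coxMap (D.chi u) = D.coxMonomial (D.coxExp u.1) := by
      simp [coxMap, chi]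
    rw [h3, coxMonomial]
    intro h4
    obtain ⟨v, -, hv⟩ := (x.1.isPrime.prod_mem_iff).1 h4
    by_cases hvF : toReal v.1 ∈ F
    · rw [huF v hvF] at hv
      exact x.1.isPrime.ne_top ((Ideal.eq_top_iff_one _).2 (by simpa using hv))
    · refine hxF ?_
      exact (x.1.isPrime.prod_mem_iff).2 ⟨v, by simpa using hvF,
        x.1.isPrime.mem_of_pow_mem _ hv⟩
  rw [h1]
  exact h2

/-- The quotient morphism `ℂ^{Σ(1)} ∖ V(B) → X_Σ` of the homogeneous coordinate construction. -/
def coxQuotient : D.coxOpen.toScheme ⟶ D.X :=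
  toProj D.grading D.coxSections D.coxSections_cover

/-- The closed subscheme of the toric variety given by the vanishing of homogeneous polynomials
generating an ideal `J` of the homogeneous coordinate ring: the (scheme-theoretic) image of
`V(J) ∖ V(B)` under the quotient morphism `ℂ^{Σ(1)} ∖ V(B) → X_Σ`. -/
def coxSubscheme (J : Ideal D.CoxRing) : D.X.IdealSheafData :=
  ((Spec.map (CommRingCat.ofHom (Ideal.Quotient.mk J)) ∣_ D.coxOpen) ≫ D.coxQuotient).ker

/-! ### The equations in homogeneous coordinates -/

/-- The exponents of the monomial `x^n ∏_ρ x_ρ` in the homogeneous coordinates of `X_{Δ^*}`. -/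
def expF (n : Fin d → ℤ) (v : D.total.Ray) : ℤ := v.1 ⬝ᵥ Sum.elim n 0 + 1

/-- `∑_{n ∈ Δ^* ∩ ℤ^d} aₙ x^n ∏_ρ x_ρ`, in the homogeneous coordinates of `X_{Δ^*}`. -/
def F (a : D.DualPoint → ℂ) : D.total.CoxRing :=
  ∑ n, a n • D.total.coxMonomial (D.expF n.1)

/-- The exponents of `x^{n - ∑_{j ≥ 1} min ⟨Δⱼ, n⟩ eⱼ^*} ∏_{v_ρ ∈ Δ₀ + e₀} x_ρ`. -/
def expFBar (n : Fin d → ℤ) (v : D.Ray) : ℤ :=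
  v.1 ⬝ᵥ Sum.elim n (fun j => -latMin (D.part j.succ) n) + D.divisor 0 v

/-- `∑_{n ∈ Δ^* ∩ ℤ^d} aₙ x^{n - ∑_{j ≥ 1} min ⟨Δⱼ, n⟩ eⱼ^*} ∏_{v_ρ ∈ Δ₀ + e₀} x_ρ`. -/
def FBar (a : D.DualPoint → ℂ) : D.CoxRing := ∑ n, a n • D.coxMonomial (D.expFBar n.1)

/-- `∏_{v_ρ ∈ Δᵢ + eᵢ} x_ρ - ∏_{v_ρ ∈ Δ₀ + e₀} x_ρ`. -/
def G (i : Fin k) : D.CoxRing :=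
  D.coxMonomial (D.divisor i.succ) - D.coxMonomial (D.divisor 0)

/-! ### The nef-partition -/

/-- The point `u - ∑_{i ≥ 1} min ⟨Δᵢ, u⟩ eᵢ^*` of `ℝ^d ⊕ ℝ^k`. -/
def liftReal (u : Fin d → ℝ) : Fin d ⊕ Fin k → ℝ :=
  Sum.elim u fun i => -minPairing (D.part i.succ) u

/-- The vectors `eᵢ^*` of `ℝ^d ⊕ ℝ^k`, `i = 1, …, k`. -/
def eStar (i : Fin k) : Fin d ⊕ Fin k → ℝ := Pi.single (Sum.inr i) 1

/-- `∇̂₀ = conv({u - ∑_{i ≥ 1} min ⟨Δᵢ, u⟩ eᵢ^* | u ∈ Δ^*} ∪ {e₁^*, …, e_k^*})` and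
`∇̂ᵢ = ∇̂₀ - eᵢ^*` for `i = 1, …, k`. -/
def hatNabla (i : Fin (k + 1)) : Set (Fin d ⊕ Fin k → ℝ) :=
  (fun x => x - (Fin.cons 0 eStar : Fin (k + 1) → Fin d ⊕ Fin k → ℝ) i) ''
    convexHull ℝ (D.liftReal '' polar D.Δ ∪ Set.range eStar)

/-- The global sections of `O(D_Q)` in homogeneous coordinates, where
`D_Q = ∑ -min ⟨Q, v_ρ⟩ D_ρ` for a lattice polytope `Q`: the span of the monomials
`∏ x_ρ ^ (⟨m, v_ρ⟩ - min ⟨Q, v_ρ⟩)` for the lattice points `m` of `Q`. -/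
def sections (Q : Set (Fin d ⊕ Fin k → ℝ)) : Submodule ℂ D.CoxRing :=
  Submodule.span ℂ {x | ∃ m : Fin d ⊕ Fin k → ℤ, toReal m ∈ Q ∧
    x = D.coxMonomial fun v => m ⬝ᵥ v.1 - latMin Q v.1}

end MinkowskiDecomposition

/-- `P₀ + ⋯ + P_k` is a nef-partition: a decomposition of a reflexive polytope as a Minkowski sum
of lattice polytopes which contain the origin. -/
def IsNefPartition {ι κ : Type} [Fintype ι] [Fintype κ] (P : κ → Set (ι → ℝ)) : Prop :=
  IsReflexive (∑ i, P i) ∧ ∀ i, IsLatticePolytope (P i) ∧ 0 ∈ P i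

end ToricCY

end

namespace ToricCY

/-! The algebra rests on the shape of the semigroup: every element with `N`-part `n` is the minimal
one, `n - ∑ᵢ min ⟨Δᵢ, n⟩ rᵢ^*`, plus non-negative multiples of the `rᵢ^*` (`eq_lift_add`). Modulo
`g₁, …, g_j` the monomials `χ^{r₀^*}, …, χ^{r_j^*}` coincide, so two monomials become equal as soon
as they agree after adding up `α₀, …, α_j`. Hence `(g₁, …, g_j)` is the kernel of a homomorphism to
a Laurent polynomial ring (`ker_merge`); it is prime and does not contain `g_{j+1}`. For `j = k` it
is the kernel of `Ā → A` (`ker_ringProj`). Since `min ⟨Δ, n⟩ = -1` for `0 ≠ n ∈ Δ^* ∩ N`, the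
element `f̄` has degree one and maps to `f`. This gives the kernel of `Ā → A/(f)` (`ker_comp`) and
the regular sequence (`isRegular`).

A surjective graded homomorphism induces a closed immersion of `Proj`s
(`isClosedImmersion_projMap`), whose ideal sheaf depends only on the kernel of the homomorphism
(`ker_projMap_congr`). So `Y` and `Ȳ` are the same closed subscheme of `X̄`.

In homogeneous coordinates each graded part of the semigroup ring is spanned by monomials.
Projecting the coordinate ring onto these parts is linear over the semigroup ring (`coxProj_mul`).
Therefore extending a homogeneous ideal to the coordinate ring and contracting it changes it only by
elements that high degrees multiply back into the ideal, which `Proj` does not see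
(`exists_mul_mem`, `coxSubscheme_map`). It remains to match `f`, `f̄`, `gᵢ` with the given
polynomials.

For the nef-partition, `∇̂₀` is described by inequalities: at least `-1` on `Δ₀ + e₀` and at least
`0` on the other `Δᵢ + eᵢ` (`hatNabla_zero_eq`; the substance is `hatPolyhedron_subset`). Adding the
translates gives the polar of `Δ̃₀ ⊎ ⋯ ⊎ Δ̃_k` (`sum_hatNabla`), and the bipolar theorem gives the
rest. The minimum of `∇̂ᵢ` on a ray is `-1` or `0` according to whether the ray lies in `Δᵢ + eᵢ`
(`latMin_hatNabla`), which identifies the sections. -/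

theorem ker_specMap_eq {R S T : CommRingCat} (φ : R ⟶ S) (ψ : R ⟶ T)
    (h : RingHom.ker φ.hom = RingHom.ker ψ.hom) : (Spec.map φ).ker = (Spec.map ψ).ker := by
  have key : ∀ {S : CommRingCat} (φ : R ⟶ S), RingHom.ker (Spec.map φ).appTop.hom =
      (RingHom.ker φ.hom).comap (Scheme.ΓSpecIso R).hom.hom := by
    intro S φ
    ext x
    have e := congr($(Scheme.ΓSpecIso_naturality φ).hom x)
    simp only [CommRingCat.hom_comp, RingHom.comp_apply] at e
    rw [Ideal.mem_comap, RingHom.mem_ker, RingHom.mem_ker, ← e]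
    exact (map_eq_zero_iff _ (ConcreteCategory.bijective_of_isIso (Scheme.ΓSpecIso S).hom).1).symm
  rw [Scheme.ker_of_isAffine, Scheme.ker_of_isAffine, key, key, h]

/-! ### Closed immersions of `Proj`s and their ideal sheaves. -/

section ProjMap

variable {A B σ τ : Type} [CommRing A] [SetLike σ A] [AddSubgroupClass σ A]
  [CommRing B] [SetLike τ B] [AddSubgroupClass τ B] {𝒜 : ℕ → σ} {ℬ : ℕ → τ}
  [GradedRing 𝒜] [GradedRing ℬ] (f : 𝒜 →+*ᵍ ℬ)

theorem exists_mem_of_surjective (hf : Function.Surjective f) {n : ℕ} {b : B} (hb : b ∈ ℬ n) :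
    ∃ a ∈ 𝒜 n, f a = b := by
  obtain ⟨a, rfl⟩ := hf b
  exact ⟨DirectSum.decompose 𝒜 a n, SetLike.coe_mem _, by
    rw [f.map_directSumDecompose, DirectSum.decompose_of_mem_same ℬ hb]⟩

theorem awayMap_surjective (hf : Function.Surjective f) {i : ℕ} {s : A} (hs : s ∈ 𝒜 i) :
    Function.Surjective (HomogeneousLocalization.Away.map f s) := by
  intro y
  obtain ⟨n, b, hb, rfl⟩ := HomogeneousLocalization.Away.mk_surjective _ (f.map_mem hs) y
  obtain ⟨a, ha, rfl⟩ := exists_mem_of_surjective f hf hb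
  exact ⟨HomogeneousLocalization.Away.mk _ hs n a ha, HomogeneousLocalization.Away.map_mk ..⟩

theorem isPullback_projMap (h : ℬ₊ ≤ 𝒜₊.map f) {i : ℕ} (hi : 0 < i) {s : A} (hs : s ∈ 𝒜 i) :
    IsPullback (Spec.map (CommRingCat.ofHom (HomogeneousLocalization.Away.map f s)))
      (Proj.awayι ℬ (f s) (f.2 hs) hi) (Proj.awayι 𝒜 s hs hi) (Proj.map f h) :=
  IsOpenImmersion.isPullback _ _ _ _ (Proj.awayι_comp_map f h hi s hs) <| by
    rw [Proj.opensRange_awayι, Proj.opensRange_awayι, Proj.map_preimage_basicOpen]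

/-- A surjective homomorphism of graded rings induces a closed immersion of `Proj`s. -/
theorem isClosedImmersion_projMap (hf : Function.Surjective f) (h : ℬ₊ ≤ 𝒜₊.map f) :
    IsClosedImmersion (Proj.map f h) := by
  refine IsZariskiLocalAtTarget.of_openCover (P := @IsClosedImmersion)
    (Proj.affineOpenCover 𝒜).openCover fun s => ?_
  have hc : IsClosedImmersion
      (Spec.map (CommRingCat.ofHom (HomogeneousLocalization.Away.map f s.2.1))) :=
    IsClosedImmersion.spec_of_surjective _ (awayMap_surjective f hf s.2.2)
  rw [← (isPullback_projMap f h s.1.2 s.2.2).flip.isoPullback_hom_snd,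
    MorphismProperty.cancel_left_of_respectsIso @IsClosedImmersion] at hc
  exact hc

/-- The kernel of a morphism on an affine chart of `Proj`, as an ideal sheaf on `Proj`. -/
noncomputable def chartKer {i : ℕ} (hi : 0 < i) {s : A} (hs : s ∈ 𝒜 i) {R : Type} [CommRing R]
    (φ : HomogeneousLocalization.Away 𝒜 s →+* R) : (Proj 𝒜).IdealSheafData :=
  Scheme.Hom.ker (Spec.map (CommRingCat.ofHom φ) ≫ Proj.awayι 𝒜 s hs hi)

theorem chartKer_congr {i : ℕ} (hi : 0 < i) {s : A} (hs : s ∈ 𝒜 i) {R S : Type} [CommRing R]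
    [CommRing S] (φ : HomogeneousLocalization.Away 𝒜 s →+* R)
    (ψ : HomogeneousLocalization.Away 𝒜 s →+* S) (h : RingHom.ker φ = RingHom.ker ψ) :
    chartKer hi hs φ = chartKer hi hs ψ := by
  rw [chartKer, chartKer, ← Scheme.IdealSheafData.map_ker, ← Scheme.IdealSheafData.map_ker,
    ker_specMap_eq (CommRingCat.ofHom φ) (CommRingCat.ofHom ψ) h]

/-- The kernel of a morphism of `Proj`s is determined by the kernels on the affine charts. -/
theorem ker_projMap (h : ℬ₊ ≤ 𝒜₊.map f) [QuasiCompact (Proj.map f h)] :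
    Scheme.Hom.ker (Proj.map f h) = ⨅ s : Σ i : PNat, 𝒜 i,
      chartKer s.1.2 s.2.2 (HomogeneousLocalization.Away.map f s.2.1) := by
  -- By `h` the charts `D₊(f s)` with `s` homogeneous in `A` already cover `Proj ℬ`, so the kernel
  -- is the infimum over them.
  refine (Scheme.Hom.iInf_ker_openCover_map_comp (Proj.map f h)
    (Proj.mapAffineOpenCover f h).openCover).symm.trans (iInf_congr fun s => ?_)
  exact congrArg Scheme.Hom.ker (Proj.awayι_comp_map f h s.1.2 s.2.1 s.2.2)

end ProjMap

/-! ### Morphisms from affine schemes through `toProj`. -/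

section ToProj

variable {A σ : Type} [CommRing A] [SetLike σ A] [AddSubgroupClass σ A] (𝒜 : ℕ → σ)
  [GradedRing 𝒜] {X : Scheme.{0}} (φ : A →+* Γ(X, ⊤))
  (hφ : TopologicalSpace.IsOpenCover
    (fun ir : Σ' i r, 0 < i ∧ r ∈ 𝒜 i => X.basicOpen (φ ir.2.1)))

/-- Since `s` becomes a unit in `R`, the morphism `m` factors through `D(φ(s))`, where `toProj` is
given by a ring homomorphism on `A_(s)`. This makes the quotient morphism computable on charts. -/
theorem comp_toProj {R : CommRingCat.{0}} (m : Spec R ⟶ X) {i : ℕ} (hi : 0 < i) {s : A}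
    (hs : s ∈ 𝒜 i) (p : A →+* R) (hp : p = ((Scheme.ΓSpecIso R).hom.hom.comp m.appTop.hom).comp φ)
    (hu : IsUnit (p s)) :
    m ≫ toProj 𝒜 φ hφ = Spec.map (CommRingCat.ofHom
      ((IsLocalization.Away.lift (S := Localization.Away s) s hu).comp
        (algebraMap (HomogeneousLocalization.Away 𝒜 s) (Localization.Away s)))) ≫
      Proj.awayι 𝒜 s hs hi := by
  subst hp
  have hr : Set.range m ⊆ Set.range (X.basicOpen (φ s)).ι := by
    rw [Scheme.Opens.range_ι]
    rintro _ ⟨x, rfl⟩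
    have h1 : m ⁻¹ᵁ X.basicOpen (φ s) = ⊤ := by
      rw [Scheme.preimage_basicOpen]
      refine Scheme.basicOpen_of_isUnit _ ?_
      exact (MulEquiv.isUnit_map (Scheme.ΓSpecIso R).commRingCatIsoToRingEquiv.toMulEquiv).1 hu
    exact h1.ge (Set.mem_univ x)
  obtain ⟨m, rfl⟩ : ∃ m', m' ≫ (X.basicOpen (φ s)).ι = m := ⟨_, IsOpenImmersion.lift_fac _ m hr⟩
  have h1 : (X.basicOpen (φ s)).ι ≫ toProj 𝒜 φ hφ =
      Proj.toBasicOpenOfGlobalSections 𝒜 φ rfl hi hs ≫ Scheme.Opens.ι _ :=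
    (X.openCoverOfIsOpenCover _ hφ).ι_glueMorphisms _ _ ⟨i, s, hi, hs⟩
  rw [Category.assoc, h1, Proj.toBasicOpenOfGlobalSections]
  have h2 : m ≫ (X.isoOfEq (X.toSpecΓ_preimage_basicOpen (φ s))).inv ≫
      X.toSpecΓ ∣_ (PrimeSpectrum.basicOpen (φ s)) ≫ (basicOpenIsoSpecAway (φ s)).hom =
      Spec.map (CommRingCat.ofHom (IsLocalization.Away.lift (S := Localization.Away (φ s))
        (g := (Scheme.ΓSpecIso R).hom.hom.comp (m ≫ (X.basicOpen (φ s)).ι).appTop.hom)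
        (φ s) hu)) := by
    -- The spectrum of a localization maps monomorphically to `Spec Γ(X, ⊤)`, so the two sides may
    -- be compared there.
    rw [← cancel_mono (Spec.map (CommRingCat.ofHom (algebraMap Γ(X, ⊤) _)))]
    simp only [Category.assoc, basicOpenIsoSpecAway_hom_SpecMap]
    trans (m ≫ (X.basicOpen (φ s)).ι) ≫ X.toSpecΓ
    · have := morphismRestrict_ι X.toSpecΓ (PrimeSpectrum.basicOpen (φ s))
      rw [this]
      simp
    · rw [Scheme.toSpecΓ_naturality, ← SpecMap_ΓSpecIso_hom, ← Spec.map_comp, ← Spec.map_comp,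
        ← CommRingCat.ofHom_comp, IsLocalization.Away.lift_comp]
      rfl
  simp only [Category.assoc, Proj.basicOpenIsoSpec_inv_ι, CommRingCat.ofHom_comp, Spec.map_comp]
  simp only [← Category.assoc] at h2 ⊢
  rw [h2]
  simp only [← Spec.map_comp, ← CommRingCat.ofHom_comp]
  congr 4
  refine IsLocalization.ringHom_ext (Submonoid.powers s) ?_
  ext x
  simp

end ToProj

/-! ### Lattice points and lattice polytopes. -/

theorem toReal_add {ι : Type} (a b : ι → ℤ) : toReal (a + b) = toReal a + toReal b := by
  ext i; simp [toReal]

theorem toReal_neg {ι : Type} (a : ι → ℤ) : toReal (-a) = -toReal a := by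
  ext i; simp [toReal]

@[simp]
theorem toReal_zero {ι : Type} : toReal (0 : ι → ℤ) = 0 := by
  ext i; simp [toReal]

theorem toReal_eq_zero {ι : Type} {a : ι → ℤ} : toReal a = 0 ↔ a = 0 :=
  ⟨fun h => toReal_injective (h.trans toReal_zero.symm), fun h => h ▸ toReal_zero⟩

theorem IsLatticePolytope.isCompact {ι : Type} [Fintype ι] {P : Set (ι → ℝ)}
    (hP : IsLatticePolytope P) : IsCompact P := by
  obtain ⟨s, -, rfl⟩ := hP
  exact (s.finite_toSet.image _).isCompact_convexHull ℝ

theorem IsLatticePolytope.convex {ι : Type} {P : Set (ι → ℝ)} (hP : IsLatticePolytope P) :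
    Convex ℝ P := by
  obtain ⟨s, -, rfl⟩ := hP
  exact convex_convexHull ℝ _

theorem convex_setOf_le_dotProduct {ι : Type} [Fintype ι] (c : ℝ) (y : ι → ℝ) :
    Convex ℝ {x : ι → ℝ | c ≤ x ⬝ᵥ y} :=
  convex_halfSpace_ge ⟨fun x z => add_dotProduct x z _, fun a x => smul_dotProduct a x _⟩ _

theorem continuous_dotProduct_right {ι : Type} [Fintype ι] (y : ι → ℝ) :
    Continuous fun x : ι → ℝ => x ⬝ᵥ y := by
  unfold dotProduct; fun_prop

/-- The extreme points of a lattice polytope are lattice points, and they suffice to bound linear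
forms. -/
theorem IsLatticePolytope.le_dotProduct {ι : Type} [Fintype ι] {P : Set (ι → ℝ)}
    (hP : IsLatticePolytope P) {c : ℝ} {y : ι → ℝ}
    (h : ∀ v : ι → ℤ, toReal v ∈ P.extremePoints ℝ → c ≤ toReal v ⬝ᵥ y) {x : ι → ℝ} (hx : x ∈ P) :
    c ≤ x ⬝ᵥ y := by
  -- Krein–Milman reduces the bound to extreme points, which belong to the finite generating set and
  -- so are lattice points.
  have h1 := closure_convexHull_extremePoints hP.isCompact hP.convex
  rw [← h1] at hx
  refine closure_minimal (convexHull_min (fun z hz => ?_) (convex_setOf_le_dotProduct c y))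
    (isClosed_le continuous_const (continuous_dotProduct_right y)) hx
  obtain ⟨s, hs, rfl⟩ := hP
  obtain ⟨v, -, rfl⟩ := extremePoints_convexHull_subset hz
  exact h v hz

/-! ### Exponents in homogeneous coordinates as affine functions on `Δ̃₀ ⊎ ⋯ ⊎ Δ̃_k`. -/

namespace MinkowskiDecomposition

variable {d k : ℕ} (D : MinkowskiDecomposition d k)

theorem isLatticePolytope_tilde : IsLatticePolytope D.tilde := by
  classical
  choose s hs hP using D.isLatticePolytope
  refine ⟨insert 0 (Finset.univ.biUnion fun i =>
    (s i).image fun m => (Sum.elim m (0 : Fin k → ℤ) + eVec i : Fin d ⊕ Fin k → ℤ)),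
    Finset.insert_nonempty _ _, ?_⟩
  have e : ∀ (i : Fin (k + 1)) (m : Fin d → ℤ),
      toReal (Sum.elim m (0 : Fin k → ℤ) + eVec i : Fin d ⊕ Fin k → ℤ) =
      (Sum.elim (toReal m) (0 : Fin k → ℝ) + toReal (eVec i) : Fin d ⊕ Fin k → ℝ) := by
    intro i m
    rw [toReal_add]
    congr 1
    ext (j | j) <;> simp [toReal]
  rw [tilde_eq]
  apply subset_antisymm
  · refine convexHull_min (Set.insert_subset ?_ (Set.iUnion_subset fun i => ?_))
      (convex_convexHull ℝ _)
    · exact subset_convexHull ℝ _ ⟨0, by simp, toReal_zero⟩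
    · let L : (Fin d → ℝ) →ₗ[ℝ] (Fin d ⊕ Fin k → ℝ) :=
        { toFun := fun m => Sum.elim m 0
          map_add' := fun a b => by ext (j | j) <;> simp
          map_smul' := fun a b => by ext (j | j) <;> simp }
      rintro _ ⟨m, hm, rfl⟩
      rw [hP] at hm
      have hconv := ((convex_convexHull ℝ (toReal '' ((insert 0 (Finset.univ.biUnion fun i =>
        (s i).image fun m => Sum.elim m (0 : Fin k → ℤ) + eVec i) : Finset (Fin d ⊕ Fin k → ℤ)) :
          Set (Fin d ⊕ Fin k → ℤ)))).translate_preimage_right (toReal (eVec i))).linear_preimage L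
      refine Set.mem_of_eq_of_mem (add_comm _ _) (convexHull_min ?_ hconv hm)
      rintro _ ⟨m, hm, rfl⟩
      refine subset_convexHull ℝ _ ⟨Sum.elim m (0 : Fin k → ℤ) + eVec i, ?_,
        (e i m).trans (add_comm _ _)⟩
      simp only [Finset.coe_insert, Finset.coe_biUnion, Finset.coe_image]
      exact Or.inr (Set.mem_biUnion (by simp) ⟨m, hm, rfl⟩)
  · refine convexHull_mono ?_
    rintro _ ⟨v, hv, rfl⟩
    simp only [Finset.coe_insert, Finset.coe_biUnion, Finset.coe_image] at hv
    rcases hv with rfl | hv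
    · exact Or.inl toReal_zero
    · obtain ⟨i, -, m, hm, rfl⟩ := Set.mem_iUnion₂.1 hv
      refine Or.inr (Set.mem_iUnion.2 ⟨i, toReal m, ?_, (e i m).symm⟩)
      rw [hP]
      exact subset_convexHull ℝ _ ⟨m, hm, rfl⟩

theorem shifted_subset_tilde (i : Fin (k + 1)) : D.shifted i ⊆ D.tilde := by
  rw [tilde_eq]
  exact fun x hx => subset_convexHull ℝ _ (Or.inr (Set.mem_iUnion.2 ⟨i, hx⟩))

theorem zero_mem_tilde : 0 ∈ D.tilde := by
  rw [tilde_eq]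
  exact subset_convexHull ℝ _ (Or.inl rfl)

theorem shift_dotProduct (i : Fin (k + 1)) (m n : Fin d → ℝ) (β : Fin k → ℝ) :
    (Sum.elim m (0 : Fin k → ℝ) + toReal (eVec i) : Fin d ⊕ Fin k → ℝ) ⬝ᵥ Sum.elim n β =
      m ⬝ᵥ n + (Fin.cons (-∑ j, β j) β : Fin (k + 1) → ℝ) i := by
  rw [add_dotProduct, sumElim_dotProduct_sumElim, zero_dotProduct, add_zero]
  congr 1
  refine Fin.cases ?_ (fun i => ?_) i
  · simp [eVec, toReal, dotProduct]
  · simp [eVec, toReal, dotProduct]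

theorem coxExp_add (u w : Fin d ⊕ Fin (k + 1) → ℤ) (v : D.Ray) :
    D.coxExp (u + w) v = D.coxExp u v + D.coxExp w v := by
  simp only [coxExp, dotProduct, Fintype.sum_sum_type,
    Sum.elim_inl, Sum.elim_inr, Function.comp_apply, Pi.add_apply, mul_add, add_mul,
    Finset.sum_add_distrib]
  ring

theorem coxExp_neg (u : Fin d ⊕ Fin (k + 1) → ℤ) (v : D.Ray) :
    D.coxExp (-u) v = -D.coxExp u v := by
  have h := D.coxExp_add u (-u) v
  have h0 : D.coxExp 0 v = 0 := by simp [coxExp, dotProduct]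
  rw [add_neg_cancel, h0] at h
  linarith

/-- Subtracting the average `deg / (k + 1)` from every `αᵢ` makes their sum zero. The `αᵢ` are then
the values on the `eᵢ` of one linear form on `ℝ^k`, because `e₀ = -(e₁ + ⋯ + e_k)`. Exponents
thereby become values of a single affine function with constant term `deg / (k + 1)`. -/
theorem exists_affine_eq (w : Fin d ⊕ Fin (k + 1) → ℤ) : ∃ y : Fin d ⊕ Fin k → ℝ,
    (∀ i m, (Sum.elim m (0 : Fin k → ℝ) + toReal (eVec i) : Fin d ⊕ Fin k → ℝ) ⬝ᵥ y =
      m ⬝ᵥ toReal (w ∘ Sum.inl) + w (Sum.inr i) - (∑ j, w (Sum.inr j) : ℤ) / (k + 1)) ∧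
    ∀ v : D.Ray, (D.coxExp w v : ℝ) =
      toReal v.1 ⬝ᵥ y + (∑ j, w (Sum.inr j) : ℤ) / (k + 1) := by
  have key : ∀ i m, (Sum.elim m (0 : Fin k → ℝ) + toReal (eVec i) : Fin d ⊕ Fin k → ℝ) ⬝ᵥ
      Sum.elim (toReal (w ∘ Sum.inl))
        (fun j => w (Sum.inr j.succ) - (∑ j, w (Sum.inr j) : ℤ) / (k + 1)) =
      m ⬝ᵥ toReal (w ∘ Sum.inl) + w (Sum.inr i) - (∑ j, w (Sum.inr j) : ℤ) / (k + 1) := by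
    intro i m
    rw [shift_dotProduct, add_sub_assoc]
    congr 1
    refine Fin.cases ?_ (fun i => ?_) i
    · have : (k + 1 : ℝ) ≠ 0 := by positivity
      simp only [Fin.cons_zero, Finset.sum_sub_distrib, Finset.sum_const, Finset.card_univ,
        Fintype.card_fin, nsmul_eq_mul]
      rw [Fin.sum_univ_succ (fun j => w (Sum.inr j))]
      push_cast
      field_simp
      ring
    · simp
  refine ⟨_, key, fun v => ?_⟩
  obtain ⟨i, m, hm, e⟩ := D.exists_mem_shifted v
  change _ = toReal v.1 at e
  rw [← e, key, D.coxExp_eq w v e hm]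
  ring

/-- An affine function that is non-negative at the vertices is non-negative on the polytope. A
vertex `0` is no ray and needs its own argument: there the value is `deg / (k + 1) ≥ 0`. -/
theorem neg_le_dotProduct_of_mem_tilde {w : Fin d ⊕ Fin (k + 1) → ℤ}
    (hw : 0 ≤ ∑ i, w (Sum.inr i)) (h : ∀ v, 0 ≤ D.coxExp w v) {y : Fin d ⊕ Fin k → ℝ}
    (hy : ∀ v : D.Ray, (D.coxExp w v : ℝ) =
      toReal v.1 ⬝ᵥ y + (∑ j, w (Sum.inr j) : ℤ) / (k + 1)) {x : Fin d ⊕ Fin k → ℝ}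
    (hx : x ∈ D.tilde) : -((∑ j, w (Sum.inr j) : ℤ) / (k + 1)) ≤ x ⬝ᵥ y := by
  refine D.isLatticePolytope_tilde.le_dotProduct (fun v hv => ?_) hx
  by_cases hv0 : v = 0
  · rw [hv0, toReal_zero, zero_dotProduct, neg_nonpos]
    exact div_nonneg (by exact_mod_cast hw) (by positivity)
  · have h1 := hy ⟨v, hv, hv0⟩
    have h2 : (0 : ℝ) ≤ D.coxExp w ⟨v, hv, hv0⟩ := by exact_mod_cast h _
    linarith

/-- An element of the lattice of non-negative degree belongs to the semigroup if the exponents of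
the corresponding monomial in homogeneous coordinates are non-negative. -/
theorem mem_monoid_of_coxExp_nonneg {w : Fin d ⊕ Fin (k + 1) → ℤ} (hw : 0 ≤ ∑ i, w (Sum.inr i))
    (h : ∀ v, 0 ≤ D.coxExp w v) : w ∈ D.monoid := by
  obtain ⟨y, hy, hy'⟩ := D.exists_affine_eq w
  rw [mem_monoid]
  intro i m hm
  have := D.neg_le_dotProduct_of_mem_tilde hw h hy' (D.shifted_subset_tilde i ⟨m, hm, rfl⟩)
  rw [hy] at this
  linarith

/-- Both `w` and `-w` lie in the semigroup, so all its defining inequalities are equalities at `w`.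
Adding them up shows that the `N`-part vanishes on `Δ`, a neighbourhood of `0`; hence it is zero,
and then so are the `αᵢ`. In a fixed degree, exponents thus determine the semigroup element. -/
theorem eq_zero_of_coxExp_eq_zero {w : Fin d ⊕ Fin (k + 1) → ℤ} (hw : ∑ i, w (Sum.inr i) = 0)
    (h : ∀ v, D.coxExp w v = 0) : w = 0 := by
  have h1 := (D.mem_monoid w).1 (D.mem_monoid_of_coxExp_nonneg hw.ge fun v => (h v).ge)
  have h2 := (D.mem_monoid (-w)).1 (D.mem_monoid_of_coxExp_nonneg (by simp [hw])
    fun v => by rw [D.coxExp_neg, h, neg_zero])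
  have h3 : ∀ i, ∀ m ∈ D.part i, m ⬝ᵥ toReal (w ∘ Sum.inl) + w (Sum.inr i) = 0 := by
    intro i m hm
    refine le_antisymm ?_ (h1 i m hm)
    have h4 := h2 i m hm
    have e : toReal ((-w) ∘ Sum.inl) = -toReal (w ∘ Sum.inl) := toReal_neg _
    rw [e, dotProduct_neg, Pi.neg_apply, Int.cast_neg] at h4
    linarith
  have h5 : toReal (w ∘ Sum.inl) = 0 := by
    by_contra hne
    obtain ⟨x, hx, hx0⟩ := D.exists_dotProduct_neg hne
    obtain ⟨m, hm, rfl⟩ := D.mem_Δ.1 hx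
    have h6 := Finset.sum_eq_zero fun i (_ : i ∈ Finset.univ) => h3 i (m i) (hm i)
    rw [Finset.sum_add_distrib, ← sum_dotProduct] at h6
    have h7 : (∑ i, (w (Sum.inr i) : ℝ)) = 0 := by exact_mod_cast hw
    linarith
  ext (j | i)
  · exact congrFun (toReal_eq_zero.1 h5) j
  · obtain ⟨m, hm⟩ := D.part_nonempty i
    have := h3 i m hm
    rw [h5, dotProduct_zero, zero_add] at this
    exact_mod_cast this

theorem sum_eq_deg (u : D.monoid) : ∑ i, u.1 (Sum.inr i) = D.deg u :=
  (Int.toNat_of_nonneg (D.degree_nonneg u)).symm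

/-- The exponents of the monomial in homogeneous coordinates corresponding to an element of the
semigroup. -/
noncomputable def coxExponent (u : D.monoid) : D.Ray →₀ ℕ :=
  Finsupp.equivFunOnFinite.symm fun v => (D.coxExp u.1 v).toNat

theorem coe_coxExponent (u : D.monoid) (v : D.Ray) : (D.coxExponent u v : ℤ) = D.coxExp u.1 v :=
  Int.toNat_of_nonneg (D.coxExp_nonneg u v)

theorem coxExponent_add (u w : D.monoid) :
    D.coxExponent (u + w) = D.coxExponent u + D.coxExponent w := by
  ext v
  rw [Finsupp.add_apply]
  zify
  simp only [coe_coxExponent]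
  exact D.coxExp_add u.1 w.1 v

theorem coxExponent_injective {u w : D.monoid} (h : D.deg u = D.deg w)
    (h' : D.coxExponent u = D.coxExponent w) : u = w := by
  refine Subtype.ext (sub_eq_zero.1 (D.eq_zero_of_coxExp_eq_zero ?_ fun v => ?_))
  · simp only [Pi.sub_apply, Finset.sum_sub_distrib, sum_eq_deg, h, sub_self]
  · rw [sub_eq_add_neg, coxExp_add, coxExp_neg, ← coe_coxExponent, ← coe_coxExponent, h',
      add_neg_cancel]

theorem coxMonomial_coxExp (u : D.monoid) :
    D.coxMonomial (D.coxExp u.1) = MvPolynomial.monomial (D.coxExponent u) 1 := by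
  rw [MvPolynomial.monomial_eq, map_one, one_mul, Finsupp.prod_fintype _ _ fun _ => pow_zero _]
  rfl

theorem coxMap_single (u : D.monoid) (c : ℂ) :
    D.coxMap (AddMonoidAlgebra.single u c) = MvPolynomial.monomial (D.coxExponent u) c := by
  have : D.coxMap (AddMonoidAlgebra.single u c) = c • D.coxMonomial (D.coxExp u.1) := by
    simp [coxMap]
  rw [this, coxMonomial_coxExp, MvPolynomial.smul_monomial, smul_eq_mul, mul_one]

theorem coxMap_chi (u : D.monoid) : D.coxMap (D.chi u) = D.coxMonomial (D.coxExp u.1) := by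
  rw [chi, coxMap_single, coxMonomial_coxExp]

theorem coxMap_smul (c : ℂ) (x : D.Ring) : D.coxMap (c • x) = c • D.coxMap x := by
  simp [coxMap]

/-! ### Projecting the homogeneous coordinate ring onto the semigroup ring. -/

open Classical in
/-- The projection of the homogeneous coordinate ring onto the part of degree `n` of the semigroup
ring. -/
noncomputable def coxProj (n : ℕ) : D.CoxRing →ₗ[ℂ] D.Ring :=
  (MvPolynomial.basisMonomials D.Ray ℂ).constr ℂ fun e =>
    if h : ∃ u : D.monoid, D.deg u = n ∧ D.coxExponent u = e then D.chi h.choose else 0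

open Classical in
theorem coxProj_monomial (n : ℕ) (e : D.Ray →₀ ℕ) (c : ℂ) :
    D.coxProj n (MvPolynomial.monomial e c) =
      c • if h : ∃ u : D.monoid, D.deg u = n ∧ D.coxExponent u = e then D.chi h.choose else 0 := by
  have : MvPolynomial.monomial e c = c • MvPolynomial.basisMonomials D.Ray ℂ e := by
    rw [MvPolynomial.coe_basisMonomials, MvPolynomial.smul_monomial, smul_eq_mul, mul_one]
  rw [this, map_smul, coxProj, Module.Basis.constr_basis]

theorem coxProj_monomial_coxExponent (u : D.monoid) (c : ℂ) :
    D.coxProj (D.deg u) (MvPolynomial.monomial (D.coxExponent u) c) =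
      AddMonoidAlgebra.single u c := by
  have h : ∃ w : D.monoid, D.deg w = D.deg u ∧ D.coxExponent w = D.coxExponent u := ⟨u, rfl, rfl⟩
  rw [coxProj_monomial, dif_pos h, D.coxExponent_injective h.choose_spec.1 h.choose_spec.2]
  simp [chi]

theorem coxProj_monomial_eq_zero {n : ℕ} {e : D.Ray →₀ ℕ} (c : ℂ)
    (h : ¬ ∃ u : D.monoid, D.deg u = n ∧ D.coxExponent u = e) :
    D.coxProj n (MvPolynomial.monomial e c) = 0 := by
  rw [coxProj_monomial, dif_neg h, smul_zero]

/-- If `x^e` times the monomial of `u` comes from some `w` of degree `n + deg u`, then `w - u` has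
degree `n ≥ 0` and exponents `e ≥ 0`, so it lies in the semigroup. Multiplying by `u` therefore
neither creates nor destroys monomials in the image. -/
theorem coxProj_monomial_mul (n : ℕ) (e : D.Ray →₀ ℕ) (c : ℂ) (u : D.monoid) (b : ℂ) :
    D.coxProj (n + D.deg u)
      (MvPolynomial.monomial e c * D.coxMap (AddMonoidAlgebra.single u b)) =
      D.coxProj n (MvPolynomial.monomial e c) * AddMonoidAlgebra.single u b := by
  rw [coxMap_single, MvPolynomial.monomial_mul]
  by_cases h : ∃ w : D.monoid, D.deg w = n ∧ D.coxExponent w = e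
  · obtain ⟨w, rfl, rfl⟩ := h
    rw [← map_add, ← coxExponent_add, coxProj_monomial_coxExponent, coxProj_monomial_coxExponent,
      AddMonoidAlgebra.single_mul_single]
  · rw [coxProj_monomial_eq_zero _ _ h, zero_mul, coxProj_monomial_eq_zero]
    rintro ⟨w, hw, hwe⟩
    have hd : ∑ i, (w.1 - u.1) (Sum.inr i) = n := by
      simp only [Pi.sub_apply, Finset.sum_sub_distrib, sum_eq_deg, hw]
      push_cast
      ring
    have he : ∀ v, D.coxExp (w.1 - u.1) v = e v := fun v => by
      rw [sub_eq_add_neg, coxExp_add, coxExp_neg, ← coe_coxExponent, ← coe_coxExponent, hwe]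
      simp
    have hm : w.1 - u.1 ∈ D.monoid := D.mem_monoid_of_coxExp_nonneg (hd ▸ Int.natCast_nonneg n)
      fun v => he v ▸ Int.natCast_nonneg _
    refine h ⟨⟨_, hm⟩, ?_, ?_⟩
    · zify
      rw [← sum_eq_deg]
      exact hd
    · ext v
      zify
      rw [coe_coxExponent]
      exact he v

/-- The projections onto the graded parts are linear over the semigroup ring. -/
theorem coxProj_mul (n : ℕ) {m : ℕ} (c : D.CoxRing) {x : D.Ring} (hx : x ∈ D.grading m) :
    D.coxProj (n + m) (c * D.coxMap x) = D.coxProj n c * x := by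
  induction c using MvPolynomial.induction_on' with
  | add p q hp hq => rw [add_mul, map_add, map_add, add_mul, hp, hq]
  | monomial e c =>
    rw [← AddMonoidAlgebra.sum_coeff_single x, Finsupp.sum, map_sum, Finset.mul_sum, Finset.mul_sum,
      map_sum]
    refine Finset.sum_congr rfl fun u hu => ?_
    obtain rfl := hx u hu
    exact D.coxProj_monomial_mul n e c u _

theorem coxProj_one : D.coxProj 0 1 = 1 := by
  have h := D.coxProj_monomial_coxExponent 0 1
  have h0 : D.coxExponent 0 = 0 := by simpa using D.coxExponent_add 0 0
  rw [h0, map_zero] at h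
  exact h

theorem coxProj_coxMap {m : ℕ} {x : D.Ring} (hx : x ∈ D.grading m) :
    D.coxProj m (D.coxMap x) = x := by
  simpa [coxProj_one] using D.coxProj_mul 0 1 hx

/-- By linearity, the projection to degree `n` of a multiple of `x ∈ I` is a combination of the
homogeneous components of `x`, which lie in `I`. The bound `M` keeps `n` at least as large as the
degrees of these components. -/
theorem exists_coxProj_mem (I : HomogeneousIdeal D.grading) {y : D.CoxRing}
    (hy : y ∈ I.toIdeal.map D.coxMap) :
    ∃ M, ∀ n ≥ M, ∀ c, D.coxProj n (c * y) ∈ I.toIdeal := by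
  classical
  induction hy using Submodule.span_induction with
  | mem y hy =>
    obtain ⟨x, hx, rfl⟩ := hy
    refine ⟨(DirectSum.decompose D.grading x).support.sup id, fun n hn c => ?_⟩
    rw [← DirectSum.sum_support_decompose D.grading x, map_sum, Finset.mul_sum, map_sum]
    refine Ideal.sum_mem _ fun i hi => ?_
    obtain ⟨j, rfl⟩ := Nat.exists_eq_add_of_le' ((Finset.le_sup (f := id) hi).trans hn)
    refine D.coxProj_mul j c (SetLike.coe_mem _) ▸ Ideal.mul_mem_left _ _ (I.isHomogeneous i hx)
  | zero => exact ⟨0, fun n _ c => by simp⟩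
  | add y z _ _ hy hz =>
    obtain ⟨M, hM⟩ := hy
    obtain ⟨N, hN⟩ := hz
    refine ⟨max M N, fun n hn c => ?_⟩
    rw [mul_add, map_add]
    exact add_mem (hM n (le_of_max_le_left hn) c) (hN n (le_of_max_le_right hn) c)
  | smul b y _ hy =>
    obtain ⟨M, hM⟩ := hy
    refine ⟨M, fun n hn c => ?_⟩
    rw [smul_eq_mul, ← mul_assoc]
    exact hM n hn _

/-- Apply the projection to `z * x`, which it fixes. The conclusion is weaker than `x ∈ I`, but a
power of the denominator `s` of a chart may serve as `z`. -/
theorem exists_mul_mem (I : HomogeneousIdeal D.grading) {n : ℕ} {x : D.Ring}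
    (hx : x ∈ D.grading n) (h : D.coxMap x ∈ I.toIdeal.map D.coxMap) :
    ∃ M, ∀ m ≥ M, ∀ z ∈ D.grading m, z * x ∈ I.toIdeal := by
  obtain ⟨M, hM⟩ := D.exists_coxProj_mem I h
  refine ⟨M, fun m hm z hz => ?_⟩
  have h1 := hM (m + n) (by lia) (D.coxMap z)
  rwa [← map_mul, D.coxProj_coxMap (SetLike.mul_mem_graded hz hx)] at h1

end MinkowskiDecomposition

/-! ### Kernels of the homomorphisms on the charts of `Proj`. -/

theorem awayMap_eq_zero {A B σ τ : Type} [CommRing A] [SetLike σ A] [AddSubgroupClass σ A]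
    [CommRing B] [SetLike τ B] [AddSubgroupClass τ B] {𝒜 : ℕ → σ} {ℬ : ℕ → τ} [GradedRing 𝒜]
    [GradedRing ℬ] (f : 𝒜 →+*ᵍ ℬ) {i : ℕ} {s : A} (hs : s ∈ 𝒜 i) (n : ℕ) (a : A)
    (ha : a ∈ 𝒜 (n • i)) :
    HomogeneousLocalization.Away.map f s (HomogeneousLocalization.Away.mk 𝒜 hs n a ha) = 0
      ↔ ∃ N : ℕ, s ^ N * a ∈ RingHom.ker f := by
  rw [HomogeneousLocalization.Away.map_mk, ← HomogeneousLocalization.val_injective _ |>.eq_iff,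
    HomogeneousLocalization.Away.val_mk, HomogeneousLocalization.val_zero, Localization.mk_eq_mk',
    IsLocalization.mk'_eq_zero_iff]
  have e : ∀ N, f s ^ N * f a = 0 ↔ s ^ N * a ∈ RingHom.ker f := fun N => by
    rw [← map_pow, ← map_mul, RingHom.mem_ker]
  constructor
  · rintro ⟨⟨_, N, rfl⟩, h⟩
    exact ⟨N, (e N).1 h⟩
  · rintro ⟨N, h⟩
    exact ⟨⟨_, N, rfl⟩, (e N).2 h⟩

theorem isClosedImmersion_closedSubschemeι {A : Type} [CommRing A] [Algebra ℂ A]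
    {𝒜 : ℕ → Submodule ℂ A} [GradedAlgebra 𝒜] (I : HomogeneousIdeal 𝒜) :
    IsClosedImmersion (closedSubschemeι I) :=
  isClosedImmersion_projMap (quotMap I) Ideal.Quotient.mk_surjective _

theorem ker_quotMap {A : Type} [CommRing A] [Algebra ℂ A] {𝒜 : ℕ → Submodule ℂ A}
    [GradedAlgebra 𝒜] (I : HomogeneousIdeal 𝒜) : RingHom.ker (quotMap I) = I.toIdeal :=
  Ideal.mk_ker

/-- The kernel of a morphism of `Proj`s is determined by the kernel of the homomorphism of graded
rings. -/
theorem ker_projMap_congr {A B C σ τ υ : Type} [CommRing A] [SetLike σ A] [AddSubgroupClass σ A]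
    [CommRing B] [SetLike τ B] [AddSubgroupClass τ B] [CommRing C] [SetLike υ C]
    [AddSubgroupClass υ C] {𝒜 : ℕ → σ} {ℬ : ℕ → τ} {𝒞 : ℕ → υ} [GradedRing 𝒜] [GradedRing ℬ]
    [GradedRing 𝒞] (f : 𝒜 →+*ᵍ ℬ) (g : 𝒜 →+*ᵍ 𝒞) (hf : ℬ₊ ≤ 𝒜₊.map f) (hg : 𝒞₊ ≤ 𝒜₊.map g)
    [QuasiCompact (Proj.map f hf)] [QuasiCompact (Proj.map g hg)]
    (h : RingHom.ker f = RingHom.ker g) :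
    Scheme.Hom.ker (Proj.map f hf) = Scheme.Hom.ker (Proj.map g hg) := by
  rw [ker_projMap, ker_projMap]
  refine iInf_congr fun s => chartKer_congr _ _ _ _ (Ideal.ext fun x => ?_)
  obtain ⟨n, a, ha, rfl⟩ := HomogeneousLocalization.Away.mk_surjective _ s.2.2 x
  rw [RingHom.mem_ker, RingHom.mem_ker, awayMap_eq_zero, awayMap_eq_zero, h]

theorem awayLift_eq_zero {A σ : Type} [CommRing A] [SetLike σ A] [AddSubgroupClass σ A]
    {𝒜 : ℕ → σ} [GradedRing 𝒜] {R : Type} [CommRing R] (p : A →+* R) {i : ℕ} {s : A}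
    (hs : s ∈ 𝒜 i) (hu : IsUnit (p s)) (n : ℕ) (a : A) (ha : a ∈ 𝒜 (n • i)) :
    (IsLocalization.Away.lift (S := Localization.Away s) s hu).comp
      (algebraMap (HomogeneousLocalization.Away 𝒜 s) (Localization.Away s))
      (HomogeneousLocalization.Away.mk 𝒜 hs n a ha) = 0 ↔ p a = 0 := by
  rw [RingHom.comp_apply, HomogeneousLocalization.algebraMap_apply,
    HomogeneousLocalization.Away.val_mk, Localization.mk_eq_mk', IsLocalization.Away.lift,
    IsLocalization.lift_mk'_spec, mul_zero]

/-! ### The closed subscheme defined by an ideal of the homogeneous coordinate ring. -/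

namespace MinkowskiDecomposition

variable {d k : ℕ} (D : MinkowskiDecomposition d k)

/-- Some monomial `χ^u` of positive degree is non-zero at `p`. Its exponents vanish precisely on the
rays in a proper face, so all variables off that face are non-zero at `p`, and with them a generator
of `B`. This places the charts `D(s)` inside the complement of `V(B)`. -/
theorem mem_coxOpen {i : ℕ} (hi : 0 < i) {s : D.Ring} (hs : s ∈ D.grading i)
    {p : PrimeSpectrum D.CoxRing} (hp : D.coxMap s ∉ p.asIdeal) : p ∈ D.coxOpen := by
  classical
  obtain ⟨u, hu, hup⟩ : ∃ u : D.monoid, D.deg u = i ∧ D.coxMap (D.chi u) ∉ p.asIdeal := by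
    by_contra! H
    refine hp ?_
    rw [← AddMonoidAlgebra.sum_coeff_single s, Finsupp.sum, map_sum]
    refine Ideal.sum_mem _ fun u hu => ?_
    have e : AddMonoidAlgebra.single u (s.coeff u) = s.coeff u • D.chi u := by simp [chi]
    rw [e, coxMap_smul, MvPolynomial.smul_eq_C_mul]
    exact Ideal.mul_mem_left _ _ (H u (hs u hu))
  rw [coxMap_chi, coxMonomial, p.isPrime.prod_mem_iff] at hup
  push Not at hup
  obtain ⟨y, -, hy⟩ := D.exists_affine_eq u.1
  have hle := fun x => D.neg_le_dotProduct_of_mem_tilde (D.degree_nonneg u) (D.coxExp_nonneg u) hy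
    (x := x)
  set δ : ℝ := (∑ j, u.1 (Sum.inr j) : ℤ) / (k + 1) with hδ
  have hδ0 : 0 < δ := by
    refine div_pos ?_ (by positivity)
    rw [sum_eq_deg, hu]
    exact_mod_cast hi
  let l : (Fin d ⊕ Fin k → ℝ) →L[ℝ] ℝ := LinearMap.toContinuousLinearMap
    { toFun := fun x => -(x ⬝ᵥ y)
      map_add' := fun a b => by rw [add_dotProduct]; ring
      map_smul' := fun a b => by rw [smul_dotProduct]; simp }
  have hl : ∀ x, l x = -(x ⬝ᵥ y) := fun x => rfl
  -- This is where the affine function belonging to `u` takes the value zero, its smallest possible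
  -- one. The set may be empty, which `IsExposed` permits.
  have hF : IsExposed ℝ D.tilde {x ∈ D.tilde | x ⬝ᵥ y = -δ} := by
    rintro ⟨x₀, hx₀, hx₀δ⟩
    refine ⟨l, Set.ext fun x => and_congr_right fun hx => ?_⟩
    simp only [hl, neg_le_neg_iff]
    exact ⟨fun h z hz => h ▸ hle z hz, fun h => le_antisymm (hx₀δ ▸ h x₀ hx₀) (hle x hx)⟩
  refine fun hsub => ?_
  have hmem : _ ∈ p.asIdeal := hsub (Ideal.subset_span ⟨_, hF, ?_, rfl⟩)
  · rw [p.isPrime.prod_mem_iff] at hmem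
    obtain ⟨v, hv, hvp⟩ := hmem
    have hv1 : ¬ (toReal v.1 ∈ D.tilde ∧ toReal v.1 ⬝ᵥ y = -δ) := by simpa using hv
    refine hup v (Finset.mem_univ v) (Ideal.pow_mem_of_mem _ hvp _ ?_)
    have h0 : D.coxExp u.1 v ≠ 0 := by
      intro h0
      refine hv1 ⟨extremePoints_subset v.2.1, ?_⟩
      have := hy v
      rw [h0, Int.cast_zero] at this
      linarith
    have := D.coxExp_nonneg u v
    lia
  -- The face is proper: it does not contain `0`, where the linear form is `0` and not `-δ`.
  · intro h
    have h0 : (0 : Fin d ⊕ Fin k → ℝ) ∈ {x ∈ D.tilde | x ⬝ᵥ y = -δ} :=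
      h.symm.subset D.zero_mem_tilde
    have := h0.2
    rw [zero_dotProduct] at this
    linarith

theorem mem_basicOpen_coxSections {s : D.Ring} {x : D.coxOpen.toScheme} :
    x ∈ D.coxOpen.toScheme.basicOpen (D.coxSections s) ↔ D.coxMap s ∉ x.1.asIdeal := by
  have h1 : D.coxOpen.toScheme.basicOpen (D.coxSections s) =
      D.coxOpen.ι ⁻¹ᵁ PrimeSpectrum.basicOpen (D.coxMap s) := by
    rw [← basicOpen_eq_of_affine (R := .of D.CoxRing), Scheme.preimage_basicOpen]
    rfl
  rw [h1]
  rfl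

section CoxSubscheme

variable (J : Ideal D.CoxRing) {i : ℕ} (hi : 0 < i) {s : D.Ring} (hs : s ∈ D.grading i)

/-- The coordinate ring of the closed subset `V(J)` of the chart `D(s)`. -/
abbrev CoxAway (J : Ideal D.CoxRing) (s : D.Ring) : Type :=
  Localization.Away (Ideal.Quotient.mk J (D.coxMap s))

/-- The homomorphism from the semigroup ring to the coordinate ring of a chart of `V(J)`. -/
noncomputable def toCoxAway (s : D.Ring) : D.Ring →+* D.CoxAway J s :=
  (algebraMap (D.CoxRing ⧸ J) (D.CoxAway J s)).comp ((Ideal.Quotient.mk J).comp D.coxMap)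

theorem isUnit_toCoxAway (s : D.Ring) : IsUnit (D.toCoxAway J s s) :=
  IsLocalization.Away.algebraMap_isUnit (S := D.CoxAway J s)
    (Ideal.Quotient.mk J (D.coxMap s))

/-- The open subset `V(J) ∖ V(B)` of `V(J)`. -/
noncomputable abbrev coxLocus : (Spec (.of (D.CoxRing ⧸ J))).Opens :=
  Spec.map (CommRingCat.ofHom (Ideal.Quotient.mk J)) ⁻¹ᵁ D.coxOpen

theorem range_coxAway_subset {i : ℕ} (hi : 0 < i) {s : D.Ring} (hs : s ∈ D.grading i) : Set.range
    (Spec.map (CommRingCat.ofHom (algebraMap (D.CoxRing ⧸ J) (D.CoxAway J s)))) ⊆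
      Set.range (D.coxLocus J).ι := by
  rw [Scheme.Opens.range_ι]
  rintro _ ⟨x, rfl⟩
  refine D.mem_coxOpen hi hs fun h => ?_
  exact x.isPrime.ne_top (Ideal.eq_top_of_isUnit_mem _ h (D.isUnit_toCoxAway J s))

/-- The inclusion of the chart `D(s)` of `V(J)`. -/
noncomputable def coxChart : Spec (.of (D.CoxAway J s)) ⟶ (D.coxLocus J).toScheme :=
  IsOpenImmersion.lift (D.coxLocus J).ι
    (Spec.map (CommRingCat.ofHom (algebraMap (D.CoxRing ⧸ J) (D.CoxAway J s))))
    (D.range_coxAway_subset J hi hs)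

theorem coxChart_ι : D.coxChart J hi hs ≫ (D.coxLocus J).ι =
    Spec.map (CommRingCat.ofHom (algebraMap (D.CoxRing ⧸ J) (D.CoxAway J s))) :=
  IsOpenImmersion.lift_fac _ _ _

/-- On the chart `D(s)` of `V(J)` the quotient morphism lands in `D₊(s)`. Its ring homomorphism
sends a fraction `a / s^n` to the fraction of the images in the coordinate ring of the chart. -/
theorem coxChart_coxQuotient : D.coxChart J hi hs ≫
    (Spec.map (CommRingCat.ofHom (Ideal.Quotient.mk J)) ∣_ D.coxOpen) ≫ D.coxQuotient =
    Spec.map (CommRingCat.ofHom ((IsLocalization.Away.lift (S := Localization.Away s) s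
      (D.isUnit_toCoxAway J s)).comp
        (algebraMap (HomogeneousLocalization.Away D.grading s) (Localization.Away s)))) ≫
      Proj.awayι D.grading s hs hi := by
  rw [← Category.assoc, coxQuotient]
  refine comp_toProj _ _ _ _ hi hs _ ?_ _
  have h1 : (D.coxChart J hi hs ≫
      (Spec.map (CommRingCat.ofHom (Ideal.Quotient.mk J)) ∣_ D.coxOpen)) ≫ D.coxOpen.ι =
      Spec.map (CommRingCat.ofHom ((algebraMap (D.CoxRing ⧸ J) (D.CoxAway J s)).comp
        (Ideal.Quotient.mk J))) := by
    rw [Category.assoc, morphismRestrict_ι, ← Category.assoc, coxChart_ι, ← Spec.map_comp]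
    rfl
  have h2 := Scheme.ΓSpecIso_inv_naturality (CommRingCat.ofHom
    ((algebraMap (D.CoxRing ⧸ J) (D.CoxAway J s)).comp (Ideal.Quotient.mk J)))
  rw [← h1, Scheme.Hom.comp_appTop, Iso.comp_inv_eq] at h2
  refine RingHom.ext fun x => ?_
  exact congr($(h2).hom (D.coxMap x))

instance isOpenImmersion_coxChart : IsOpenImmersion (D.coxChart J hi hs) := by
  have : IsOpenImmersion (D.coxChart J hi hs ≫ (D.coxLocus J).ι) := by
    rw [coxChart_ι]
    infer_instance
  exact IsOpenImmersion.of_comp _ (D.coxLocus J).ι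

theorem exists_mem_range_coxChart (x : (D.coxLocus J).toScheme) :
    ∃ s : Σ i : PNat, D.grading i, x ∈ Set.range (D.coxChart J s.1.2 s.2.2) := by
  have hx : Spec.map (CommRingCat.ofHom (Ideal.Quotient.mk J)) x.1 ∈ D.coxOpen := x.2
  obtain ⟨⟨i, s, hi, hs⟩, h⟩ := TopologicalSpace.Opens.mem_iSup.1
    (D.coxSections_cover.ge (Set.mem_univ ⟨_, hx⟩))
  refine ⟨⟨⟨i, hi⟩, ⟨s, hs⟩⟩, ?_⟩
  have h1 := D.mem_basicOpen_coxSections.1 h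
  have h2 : x.1 ∈ Set.range
      (Spec.map (CommRingCat.ofHom (algebraMap (D.CoxRing ⧸ J) (D.CoxAway J s)))) :=
    (PrimeSpectrum.localization_away_comap_range (D.CoxAway J s) _).ge h1
  obtain ⟨z, hz⟩ := h2
  refine ⟨z, (D.coxLocus J).ι.isOpenEmbedding.injective ?_⟩
  refine (Scheme.Hom.comp_apply (D.coxChart J hi hs) (D.coxLocus J).ι z).symm.trans ?_
  rw [D.coxChart_ι J hi hs]
  exact hz

/-- The charts `D(s)` of `V(J) ∖ V(B)`. -/
noncomputable def coxCover : (D.coxLocus J).toScheme.AffineOpenCover where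
  I₀ := Σ i : PNat, D.grading i
  X s := .of (D.CoxAway J s.2.1)
  f s := D.coxChart J s.1.2 s.2.2
  idx x := (D.exists_mem_range_coxChart J x).choose
  covers x := (D.exists_mem_range_coxChart J x).choose_spec
  map_prop s := D.isOpenImmersion_coxChart J s.1.2 s.2.2

end CoxSubscheme

/-- The subscheme defined by the image of a homogeneous ideal of the semigroup ring in the
homogeneous coordinate ring. -/
theorem coxSubscheme_map (I : HomogeneousIdeal D.grading) :
    D.coxSubscheme (I.toIdeal.map D.coxMap) = (closedSubschemeι I).ker := by
  have : IsClosedImmersion (closedSubschemeι I) :=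
    isClosedImmersion_projMap (quotMap I) Ideal.Quotient.mk_surjective _
  have hq : QuasiCompact (closedSubschemeι I) := inferInstance
  -- This makes the morphism from the locus quasi-compact, so that its kernel can be computed on the
  -- charts.
  have : TopologicalSpace.NoetherianSpace (D.coxLocus (I.toIdeal.map D.coxMap)).toScheme :=
    (D.coxLocus (I.toIdeal.map D.coxMap)).ι.isOpenEmbedding.isInducing.noetherianSpace
  have h1 : (closedSubschemeι I).ker = _ := @ker_projMap _ _ _ _ _ _ _ _ _ _ _ _ _ _
    (quotMap I) (irrelevant_le_map_of_surjective _ Ideal.Quotient.mk_surjective) hq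
  rw [h1]
  refine (Scheme.Hom.iInf_ker_openCover_map_comp _
    (D.coxCover (I.toIdeal.map D.coxMap)).openCover).symm.trans (iInf_congr fun s => ?_)
  refine (congrArg Scheme.Hom.ker (D.coxChart_coxQuotient _ s.1.2 s.2.2)).trans
    (chartKer_congr _ _ _ _ (Ideal.ext fun x => ?_))
  obtain ⟨n, a, ha, rfl⟩ := HomogeneousLocalization.Away.mk_surjective _ s.2.2 x
  rw [RingHom.mem_ker, RingHom.mem_ker, awayLift_eq_zero, awayMap_eq_zero, ker_quotMap, toCoxAway,
    RingHom.comp_apply, IsLocalization.map_eq_zero_iff (Submonoid.powers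
      (Ideal.Quotient.mk (I.toIdeal.map D.coxMap) (D.coxMap s.2.1)))]
  have e : ∀ N, (Ideal.Quotient.mk (I.toIdeal.map D.coxMap) (D.coxMap s.2.1)) ^ N *
      ((Ideal.Quotient.mk (I.toIdeal.map D.coxMap)).comp D.coxMap) a = 0 ↔
      D.coxMap (s.2.1 ^ N * a) ∈ I.toIdeal.map D.coxMap := fun N => by
    rw [map_mul, map_pow, ← Ideal.Quotient.eq_zero_iff_mem, map_mul, map_pow]
    rfl
  constructor
  -- Multiplying by `s^M` reaches a degree of at least `M`, because `s` has positive degree; there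
  -- the contracted ideal is absorbed by `I`.
  · rintro ⟨⟨_, N, rfl⟩, h⟩
    obtain ⟨M, hM⟩ := D.exists_mul_mem I (SetLike.mul_mem_graded
      (SetLike.pow_mem_graded N s.2.2) ha) ((e N).1 h)
    refine ⟨M + N, ?_⟩
    rw [pow_add, mul_assoc]
    refine hM (M • (s.1 : ℕ)) ?_ _ (SetLike.pow_mem_graded M s.2.2)
    exact Nat.le_mul_of_pos_right M s.1.2
  · rintro ⟨N, h⟩
    exact ⟨⟨_, N, rfl⟩, (e N).2 (Ideal.mem_map_of_mem _ h)⟩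

end MinkowskiDecomposition

/-! ### The kernel of `Ā → A` and the regular sequence. -/

/-- The kernel of a homomorphism of semigroup rings is generated by the differences of monomials
with equal image. -/
theorem ker_mapDomainRingHom_le {M N : Type} [AddCommMonoid M] [AddCommMonoid N] (f : M →+ N)
    {I : Ideal (AddMonoidAlgebra ℂ M)}
    (h : ∀ u w, f u = f w → AddMonoidAlgebra.single u (1 : ℂ) - AddMonoidAlgebra.single w 1 ∈ I) :
    RingHom.ker (AddMonoidAlgebra.mapDomainRingHom ℂ f) ≤ I := by
  intro x hx
  have hx' : AddMonoidAlgebra.mapDomain f x = 0 := hx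
  -- Choosing one preimage for every value of `f` replaces each monomial by a chosen representative,
  -- to which it is congruent modulo `I`.
  have key : ∀ y : AddMonoidAlgebra ℂ M, Ideal.Quotient.mk I y = Ideal.Quotient.mk I
      (AddMonoidAlgebra.mapDomain (Function.invFun f) (AddMonoidAlgebra.mapDomain f y)) := by
    intro y
    induction y using AddMonoidAlgebra.induction_linear with
    | zero => simp
    | add x y hx hy =>
      rw [AddMonoidAlgebra.mapDomain_add, AddMonoidAlgebra.mapDomain_add, map_add, map_add, hx, hy]
    | single u c =>
      rw [AddMonoidAlgebra.mapDomain_single, AddMonoidAlgebra.mapDomain_single, Ideal.Quotient.eq]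
      have e := I.mul_mem_left (AddMonoidAlgebra.single 0 c)
        (h u (Function.invFun f (f u)) (Function.invFun_eq ⟨u, rfl⟩).symm)
      simpa [mul_sub, AddMonoidAlgebra.single_mul_single] using e
  rw [← Ideal.Quotient.eq_zero_iff_mem, key, hx', AddMonoidAlgebra.mapDomain_zero, map_zero]

/-- Elements which are not in the kernel of a homomorphism to a domain are regular modulo the
kernel. -/
theorem isSMulRegular_of_ker {R S : Type} [CommRing R] [CommRing S] [IsDomain S] (φ : R →+* S)
    {I : Ideal R} (hI : I = RingHom.ker φ) {r : R} (hr : φ r ≠ 0) :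
    IsSMulRegular (R ⧸ (I • ⊤ : Submodule R R)) r := by
  rw [isSMulRegular_quotient_iff_mem_of_smul_mem]
  intro x hx
  rw [smul_eq_mul, Ideal.mul_top] at hx ⊢
  rw [hI, RingHom.mem_ker] at hx ⊢
  rw [smul_eq_mul, map_mul] at hx
  exact (mul_eq_zero.1 hx).resolve_left hr

namespace MinkowskiDecomposition

variable {d k : ℕ} (D : MinkowskiDecomposition d k)

/-- The homomorphism `(n, α) ↦ (n, α₀ + ⋯ + α_j, 0, …, 0, α_{j+1}, …, α_k)`. -/
def merge (j : ℕ) : D.monoid →+ (Fin d ⊕ Fin (k + 1) → ℤ) where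
  toFun u := Sum.elim (u.1 ∘ Sum.inl) fun i =>
    if i = 0 then ∑ l : Fin (k + 1) with l.1 ≤ j, u.1 (Sum.inr l)
    else if i.1 ≤ j then 0 else u.1 (Sum.inr i)
  map_zero' := by
    ext (i | i) <;> simp
  map_add' u w := by
    ext (i | i)
    · simp
    · simp only [AddSubmonoid.coe_add, Pi.add_apply, Sum.elim_inr, Finset.sum_add_distrib]
      split_ifs <;> simp

/-- The coefficients of an element `(n, α)` of the semigroup with respect to
`n - ∑ᵢ min ⟨Δᵢ, n⟩ rᵢ^*` and the `rᵢ^*`. -/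
noncomputable def coeffR (u : D.monoid) (i : Fin (k + 1)) : ℕ :=
  (u.1 (Sum.inr i) + latMin (D.part i) (u.1 ∘ Sum.inl)).toNat

theorem coe_coeffR (u : D.monoid) (i : Fin (k + 1)) :
    (D.coeffR u i : ℤ) = u.1 (Sum.inr i) + latMin (D.part i) (u.1 ∘ Sum.inl) := by
  have := (D.mem_monoid_iff_latMin u.1).1 u.2 i
  rw [coeffR]
  lia

theorem eq_lift_add (u : D.monoid) :
    u = D.lift (u.1 ∘ Sum.inl) + ∑ i, D.coeffR u i • D.r i := by
  refine Subtype.ext ?_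
  have e : (∑ i, D.coeffR u i • D.r i : D.monoid).1 = ∑ i, D.coeffR u i • (D.r i).1 := by
    rw [AddSubmonoid.coe_finsetSum]
    rfl
  rw [AddSubmonoid.coe_add, e]
  ext (j | j)
  · simp [lift, r, Finset.sum_apply]
  · simp [lift, r, Finset.sum_apply, coe_coeffR]

theorem chi_eq (u : D.monoid) :
    D.chi u = D.chi (D.lift (u.1 ∘ Sum.inl)) * ∏ i, D.chi (D.r i) ^ D.coeffR u i := by
  have h : ∀ w, D.chi w = AddMonoidAlgebra.of ℂ D.monoid (Multiplicative.ofAdd w) := fun w => rfl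
  simp only [h]
  conv_lhs => rw [D.eq_lift_add u]
  rw [ofAdd_add, ofAdd_sum, map_mul, map_prod]
  simp only [ofAdd_nsmul, map_pow]

/-- Modulo the ideal the classes of `χ^{r_l^*}`, `l ≤ j`, coincide. The class of a monomial then
depends only on its `N`-part, on the sum of the first `j + 1` coefficients and on the remaining
coefficients. All of these can be read off from `merge j`, as the minima depend on the `N`-part
alone. -/
theorem chi_sub_chi_mem {j : ℕ} {u w : D.monoid} (h : D.merge j u = D.merge j w) :
    D.chi u - D.chi w ∈ Ideal.span (D.g '' {i | i.1 < j}) := by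
  set I := Ideal.span (D.g '' {i | i.1 < j})
  have ht : ∀ l : Fin (k + 1), l.1 ≤ j →
      Ideal.Quotient.mk I (D.chi (D.r l)) = Ideal.Quotient.mk I (D.chi (D.r 0)) := by
    intro l hl
    rcases Fin.eq_zero_or_eq_succ l with rfl | ⟨i, rfl⟩
    · rfl
    · exact Ideal.Quotient.eq.2 (Ideal.subset_span ⟨i, by simpa using hl, rfl⟩)
  have key : ∀ v : D.monoid, Ideal.Quotient.mk I (D.chi v) =
      Ideal.Quotient.mk I (D.chi (D.lift (v.1 ∘ Sum.inl))) *
        ((Ideal.Quotient.mk I (D.chi (D.r 0))) ^ (∑ l : Fin (k + 1) with l.1 ≤ j, D.coeffR v l) *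
        ∏ l : Fin (k + 1) with ¬ l.1 ≤ j, Ideal.Quotient.mk I (D.chi (D.r l)) ^ D.coeffR v l) := by
    intro v
    rw [D.chi_eq v, map_mul, map_prod,
      ← Finset.prod_filter_mul_prod_filter_not Finset.univ (fun l : Fin (k + 1) => l.1 ≤ j),
      ← Finset.prod_pow_eq_pow_sum]
    congr 2
    · refine Finset.prod_congr rfl fun l hl => ?_
      rw [map_pow, ht l (Finset.mem_filter.1 hl).2]
  have h1 : u.1 ∘ Sum.inl = w.1 ∘ Sum.inl := funext fun i => congrFun h (Sum.inl i)
  have h2 : ∀ l : Fin (k + 1), ¬ l.1 ≤ j → D.coeffR u l = D.coeffR w l := by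
    intro l hl
    have h3 := congrFun h (Sum.inr l)
    have hl0 : l ≠ 0 := by rintro rfl; simp at hl
    simp only [merge, AddMonoidHom.coe_mk, ZeroHom.coe_mk, Sum.elim_inr, hl0, hl, if_false] at h3
    rw [coeffR, coeffR, h3, h1]
  have h3 : ∑ l : Fin (k + 1) with l.1 ≤ j, D.coeffR u l =
      ∑ l : Fin (k + 1) with l.1 ≤ j, D.coeffR w l := by
    have h3 := congrFun h (Sum.inr 0)
    simp only [merge, AddMonoidHom.coe_mk, ZeroHom.coe_mk, Sum.elim_inr, if_true] at h3
    rw [← Nat.cast_inj (R := ℤ), Nat.cast_sum, Nat.cast_sum]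
    simp only [coe_coeffR, Finset.sum_add_distrib, h3, h1]
  refine Ideal.Quotient.eq.1 ?_
  rw [key u, key w, h1, h3]
  congr 2
  exact Finset.prod_congr rfl fun l hl => by rw [h2 l (Finset.mem_filter.1 hl).2]

theorem merge_r {j : ℕ} {i : Fin (k + 1)} (hi : i.1 ≤ j) :
    D.merge j (D.r i) = D.merge j (D.r 0) := by
  ext (l | l)
  · simp [merge, r]
  · have h0 : (0 : Fin (k + 1)).1 ≤ j := Nat.zero_le _
    by_cases hl : l = 0
    · simp [merge, r, hl, hi, Finset.sum_ite_eq']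
    · by_cases hl' : l.1 ≤ j
      · simp [merge, hl, hl']
      · have hli : l ≠ i := by rintro rfl; exact hl' hi
        simp [merge, r, hl, hl', hli]

/-- With indices starting at zero, `D.g '' {i | i.1 < j}` is the set of the first `j` elements `g₁,
…, g_j`. The target is the group ring of a free abelian group, a domain. -/
theorem ker_merge (j : ℕ) : RingHom.ker (AddMonoidAlgebra.mapDomainRingHom ℂ (D.merge j)) =
    Ideal.span (D.g '' {i | i.1 < j}) := by
  refine le_antisymm (ker_mapDomainRingHom_le _ fun u w h => D.chi_sub_chi_mem h) ?_
  rw [Ideal.span_le]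
  rintro _ ⟨i, hi, rfl⟩
  have h : D.merge j (D.r i.succ) = D.merge j (D.r 0) := D.merge_r (by simpa using hi)
  rw [SetLike.mem_coe, RingHom.mem_ker, g, map_sub, sub_eq_zero]
  simp [chi, h]

theorem mapDomain_merge_g_ne_zero (i : Fin k) :
    AddMonoidAlgebra.mapDomainRingHom ℂ (D.merge i.1) (D.g i) ≠ 0 := by
  rw [g, map_sub, sub_ne_zero]
  intro h
  simp only [chi, AddMonoidAlgebra.mapDomainRingHom_apply, AddMonoidAlgebra.mapDomain_single] at h
  have h1 := (AddMonoidAlgebra.single_left_inj one_ne_zero).1 h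
  have h2 := congrFun h1 (Sum.inr i.succ)
  simp [merge, r] at h2

theorem ker_ringProj : RingHom.ker D.ringProj = Ideal.span (Set.range D.g) := by
  have e : D.g '' {i | i.1 < k} = Set.range D.g := by
    rw [← Set.image_univ]
    congr 1
    ext i
    simp
  refine le_antisymm (ker_mapDomainRingHom_le D.monoidProj fun u w h => ?_) ?_
  · rw [← e]
    refine D.chi_sub_chi_mem ?_
    have h' := Subtype.ext_iff.1 h
    ext (i | i)
    · exact congrFun h' (Sum.inl i)
    · have h0 : ∑ i, u.1 (Sum.inr i) = ∑ i, w.1 (Sum.inr i) := congrFun h' (Sum.inr 0)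
      have hk : ∀ l : Fin (k + 1), l.1 ≤ k := fun l => Nat.lt_succ_iff.1 l.2
      simp [merge, hk, h0]
  · rw [Ideal.span_le]
    rintro _ ⟨i, rfl⟩
    rw [SetLike.mem_coe, RingHom.mem_ker, g, map_sub, sub_eq_zero]
    have h : D.monoidProj (D.r i.succ) = D.monoidProj (D.r 0) := by
      ext (j | j) <;> simp [monoidProj, r]
    change AddMonoidAlgebra.mapDomain _ _ = AddMonoidAlgebra.mapDomain _ _
    simp [chi, h]

theorem ringProj_chi (u : D.monoid) : D.ringProj (D.chi u) = D.total.chi (D.monoidProj u) :=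
  AddMonoidAlgebra.mapDomain_single

theorem ringProj_smul (c : ℂ) (x : D.Ring) : D.ringProj (c • x) = c • D.ringProj x :=
  map_smul (AddMonoidAlgebra.mapDomainAlgHom ℂ ℂ D.monoidProj) c x

/-- For `n ≠ 0` the minimal lift has degree `-min ⟨Δ, n⟩ = 1` and maps to `(n, 1)`. The minimal lift
of `n = 0` has degree `0`, whence the separate term `χ^{r₀^*}`. -/
theorem ringProj_fBar (a : D.DualPoint → ℂ) : D.ringProj (D.fBar a) = D.f a := by
  classical
  rw [fBar, f, map_add, map_sum, ← Finset.add_sum_erase _ _ (Finset.mem_univ (0 : D.DualPoint)),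
    Finset.filter_ne']
  congr 1
  · rw [ringProj_smul, ringProj_chi]
    congr 2
    ext (j | j)
    · rfl
    · simp [monoidProj, r, levelOne]
  · refine Finset.sum_congr rfl fun n hn => ?_
    rw [ringProj_smul, ringProj_chi]
    congr 2
    ext (j | j)
    · rfl
    · simp [monoidProj, lift, levelOne, D.sum_latMin, D.latMin_Δ n (Finset.ne_of_mem_erase hn)]

theorem levelOne_injective : Function.Injective D.levelOne := fun _ _ h =>
  Subtype.ext (funext fun i => congrFun (Subtype.ext_iff.1 h) (Sum.inl i))

theorem f_ne_zero {a : D.DualPoint → ℂ} (ha : a ≠ 0) : D.f a ≠ 0 := by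
  intro h
  refine ha (funext fun n => ?_)
  have h1 : (D.f a).coeff (D.levelOne n) = a n := by
    classical
    rw [f, AddMonoidAlgebra.coeff_sum, Finsupp.finsetSum_apply, Finset.sum_eq_single n]
    · simp [chi]
    · intro m _ hm
      simp [chi, D.levelOne_injective.ne hm]
    · simp
  rw [← h1, h]
  rfl

theorem surjective_comp (a : D.DualPoint → ℂ) :
    Function.Surjective ((quotMap (D.idealY a)).comp D.ringProj) := by
  intro y
  obtain ⟨y, rfl⟩ := Ideal.Quotient.mk_surjective y
  obtain ⟨x, rfl⟩ := D.ringProj_surjective y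
  exact ⟨x, rfl⟩

theorem ker_comp (a : D.DualPoint → ℂ) :
    RingHom.ker ((quotMap (D.idealY a)).comp D.ringProj) =
      Ideal.span (insert (D.fBar a) (Set.range D.g)) := by
  have e : ∀ x, x ∈ RingHom.ker ((quotMap (D.idealY a)).comp D.ringProj) ↔
      D.ringProj x ∈ Ideal.span {D.f a} := fun x => Ideal.Quotient.eq_zero_iff_mem
  ext x
  rw [e, Ideal.span_insert, ← ker_ringProj, Submodule.mem_sup]
  constructor
  · intro h
    obtain ⟨y, hy⟩ := Ideal.mem_span_singleton'.1 h
    obtain ⟨z, rfl⟩ := D.ringProj_surjective y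
    refine ⟨z * D.fBar a, Ideal.mem_span_singleton'.2 ⟨z, rfl⟩, x - z * D.fBar a, ?_, by ring⟩
    rw [RingHom.mem_ker, map_sub, map_mul, ringProj_fBar, hy, sub_self]
  · rintro ⟨y, hy, z, hz, rfl⟩
    obtain ⟨y, rfl⟩ := Ideal.mem_span_singleton'.1 hy
    rw [map_add, RingHom.mem_ker.1 hz, add_zero, map_mul, ringProj_fBar]
    exact Ideal.mem_span_singleton'.2 ⟨_, rfl⟩

/-- Modulo the first `i` of the `g`'s the ring embeds into a domain through `merge i`, so the next
element is regular once its image is non-zero. -/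
theorem isRegular {a : D.DualPoint → ℂ} (ha : a ≠ 0) :
    RingTheory.Sequence.IsRegular D.Ring (List.ofFn D.g ++ [D.fBar a]) := by
  have hI : ∀ i ≤ k, Ideal.ofList ((List.ofFn D.g ++ [D.fBar a]).take i) =
      RingHom.ker (AddMonoidAlgebra.mapDomainRingHom ℂ (D.merge i)) := by
    intro i hi
    rw [ker_merge, List.take_append_of_le_length (by simpa using hi), Ideal.ofList]
    congr 1
    ext x
    simp only [Set.mem_ofPred_eq, List.mem_take_iff_getElem, List.length_ofFn, Set.mem_image]
    constructor
    · rintro ⟨j, hj, rfl⟩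
      exact ⟨⟨j, by lia⟩, by simp; lia, by simp⟩
    · rintro ⟨j, hj, rfl⟩
      exact ⟨j.1, by simp; lia, by simp⟩
  refine ⟨⟨fun i hi => ?_⟩, ?_⟩
  · have hi' : i ≤ k := by simpa [Nat.lt_succ_iff] using hi
    refine isSMulRegular_of_ker _ (hI i hi') ?_
    rcases hi'.lt_or_eq with h | rfl
    · rw [List.getElem_append_left (by simpa using h), List.getElem_ofFn]
      exact D.mapDomain_merge_g_ne_zero ⟨i, h⟩
    -- If `f̄` belonged to the ideal of the `g`'s, its image `f` in `A` would vanish.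
    · rw [List.getElem_append_right (by simp)]
      simp only [List.length_ofFn, Nat.sub_self, List.getElem_cons_zero]
      intro h
      rw [← RingHom.mem_ker, ker_merge] at h
      have h1 : D.fBar a ∈ RingHom.ker D.ringProj := by
        rw [ker_ringProj]
        exact Ideal.span_mono (Set.image_subset_range _ _) h
      rw [RingHom.mem_ker, ringProj_fBar] at h1
      exact D.f_ne_zero ha h1
  -- The ideal is proper because its generators have degree one and hence lie in the irrelevant
  -- ideal.
  · rw [Ideal.smul_top_eq_map, Algebra.algebraMap_self, Ideal.map_id]
    have hle : Ideal.ofList (List.ofFn D.g ++ [D.fBar a]) ≤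
        (HomogeneousIdeal.irrelevant D.grading).toIdeal := by
      rw [Ideal.ofList, Ideal.span_le]
      intro x hx
      have h1 : x ∈ D.grading 1 := by
        simp only [List.mem_append, List.mem_ofFn, List.mem_singleton, Set.mem_ofPred_eq] at hx
        rcases hx with ⟨i, rfl⟩ | rfl
        · exact D.g_mem i
        · exact D.fBar_mem a
      exact HomogeneousIdeal.mem_irrelevant_of_mem _ one_pos h1
    intro h
    have h1 : (1 : D.Ring) ∈ HomogeneousIdeal.irrelevant D.grading :=
      hle (h.le Submodule.mem_top)
    rw [HomogeneousIdeal.mem_irrelevant_iff, GradedRing.proj_apply,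
      DirectSum.decompose_of_mem_same _ (SetLike.GradedOne.one_mem (A := D.grading))] at h1
    exact one_ne_zero h1

end MinkowskiDecomposition

/-! ### Minkowski sums, polars and minima of lattice polytopes. -/

section Polytope

variable {ι : Type}

theorem IsLatticePolytope.singleton (v : ι → ℤ) : IsLatticePolytope {toReal v} :=
  ⟨{v}, Finset.singleton_nonempty v, by simp⟩

theorem IsLatticePolytope.add {P Q : Set (ι → ℝ)} (hP : IsLatticePolytope P)
    (hQ : IsLatticePolytope Q) : IsLatticePolytope (P + Q) := by
  classical
  obtain ⟨s, hs, rfl⟩ := hP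
  obtain ⟨t, ht, rfl⟩ := hQ
  refine ⟨s + t, hs.add ht, ?_⟩
  rw [← convexHull_add, Finset.coe_add]
  congr 1
  let φ : (ι → ℤ) →+ (ι → ℝ) := ⟨⟨toReal, toReal_zero⟩, toReal_add⟩
  exact (Set.image_add φ).symm

theorem IsLatticePolytope.sum {κ : Type} {P : κ → Set (ι → ℝ)} (s : Finset κ)
    (hP : ∀ i, IsLatticePolytope (P i)) : IsLatticePolytope (∑ i ∈ s, P i) := by
  classical
  induction s using Finset.induction_on with
  | empty =>
    rw [Finset.sum_empty]
    have h := IsLatticePolytope.singleton (0 : ι → ℤ)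
    rwa [toReal_zero, Set.singleton_zero] at h
  | insert i s hi ih =>
    rw [Finset.sum_insert hi]
    exact (hP i).add ih

variable [Fintype ι]

theorem mem_polar_convexHull {S : Set (ι → ℝ)} {y : ι → ℝ} (h : ∀ x ∈ S, -1 ≤ x ⬝ᵥ y) :
    y ∈ polar (convexHull ℝ S) := fun _ hx =>
  convexHull_min (fun z hz => h z hz) (convex_setOf_le_dotProduct (-1) y) hx

/-- Finitely many strict inequalities, one for each generating point, define an open set around `0`
inside the polar. -/
theorem zero_mem_interior_polar {P : Set (ι → ℝ)} (hP : IsLatticePolytope P) :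
    0 ∈ interior (polar P) := by
  obtain ⟨s, -, rfl⟩ := hP
  have h1 : IsOpen (⋂ v ∈ s, {y : ι → ℝ | -1 < toReal v ⬝ᵥ y}) := by
    refine isOpen_biInter_finset fun v _ => ?_
    have : Continuous fun y : ι → ℝ => toReal v ⬝ᵥ y := by unfold dotProduct; fun_prop
    exact isOpen_lt continuous_const this
  refine interior_maximal (fun y hy => ?_) h1 (by simp)
  refine mem_polar_convexHull ?_
  rintro _ ⟨v, hv, rfl⟩
  exact (Set.mem_iInter₂.1 hy v hv).le

theorem exists_dotProduct_eq (f : (ι → ℝ) →L[ℝ] ℝ) : ∃ y : ι → ℝ, ∀ x, f x = x ⬝ᵥ y := by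
  classical
  refine ⟨fun i => f (Pi.single i 1), fun x => ?_⟩
  have h : x = ∑ i, x i • (Pi.single i 1 : ι → ℝ) := by
    ext j
    simp [Finset.sum_apply, Pi.single_apply]
  conv_lhs => rw [h, map_sum]
  simp [dotProduct]

/-- The bipolar theorem. -/
theorem polar_polar {P : Set (ι → ℝ)} (hP : IsLatticePolytope P) (h0 : 0 ∈ P) :
    polar (polar P) = P := by
  refine subset_antisymm (fun x hx => ?_) fun x hx y hy => by
    rw [dotProduct_comm]
    exact hy x hx
  by_contra hxP
  obtain ⟨f, u, hf, hu⟩ := geometric_hahn_banach_closed_point hP.convex hP.isCompact.isClosed hxP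
  obtain ⟨y, hy⟩ := exists_dotProduct_eq f
  have hu0 : 0 < u := by simpa using hf 0 h0
  -- As `0 ∈ P`, the separating value `u` is positive and can be scaled to `1`. The sign is reversed
  -- because polars are defined by `≥ -1`.
  have h1 : -(u⁻¹ • y) ∈ polar P := by
    intro z hz
    have h2 := (hf z hz).le
    rw [hy] at h2
    rw [dotProduct_neg, dotProduct_smul, smul_eq_mul, neg_le_neg_iff, inv_mul_le_one₀ hu0]
    exact h2
  have h2 := hx _ h1
  rw [dotProduct_comm, dotProduct_neg, dotProduct_smul, smul_eq_mul, neg_le_neg_iff,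
    inv_mul_le_one₀ hu0, ← hy] at h2
  linarith

theorem exists_dotProduct_neg_of_mem_interior {S : Set (ι → ℝ)} (hS : 0 ∈ interior S)
    {u : ι → ℝ} (hu : u ≠ 0) : ∃ x ∈ S, x ⬝ᵥ u < 0 := by
  have h1 : S ∈ nhds (0 : ι → ℝ) := mem_interior_iff_mem_nhds.1 hS
  have h2 : Filter.Tendsto (fun t : ℝ => -t • u) (nhdsWithin 0 (Set.Ioi 0)) (nhds 0) := by
    have : Continuous fun t : ℝ => -t • u := by fun_prop
    simpa using (this.tendsto 0).mono_left nhdsWithin_le_nhds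
  obtain ⟨t, ht, ht0⟩ := ((h2.eventually h1).and self_mem_nhdsWithin).exists
  refine ⟨_, ht, ?_⟩
  have h3 : 0 < u ⬝ᵥ u := by
    obtain ⟨i, hi⟩ := Function.ne_iff.1 hu
    exact Finset.sum_pos' (fun j _ => mul_self_nonneg _)
      ⟨i, Finset.mem_univ _, mul_self_pos.2 hi⟩
  rw [smul_dotProduct, smul_eq_mul]
  have : (0 : ℝ) < t := ht0
  nlinarith

/-- The missing weight is put on the point `0`, indexed by `none`. -/
theorem _root_.Convex.sum_smul_mem_of_zero_mem {E κ : Type} [AddCommGroup E] [Module ℝ E]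
    [Fintype κ] {C : Set E} (hC : Convex ℝ C) (h0 : 0 ∈ C) {w : κ → ℝ} {z : κ → E}
    (hw : ∀ i, 0 ≤ w i) (hw1 : ∑ i, w i ≤ 1) (hz : ∀ i, z i ∈ C) : ∑ i, w i • z i ∈ C := by
  have h := hC.sum_mem (t := Finset.univ) (w := fun i : Option κ => i.elim (1 - ∑ i, w i) w)
    (z := fun i : Option κ => i.elim 0 z) ?_ ?_ ?_
  · simpa [Fintype.sum_option] using h
  · rintro (_ | i) _
    · simpa using hw1
    · exact hw i
  · simp [Fintype.sum_option]
  · rintro (_ | i) _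
    · exact h0
    · exact hz i

theorem latMin_zero {P : Set (ι → ℝ)} (hP : IsLatticePolytope P) :
    latMin P 0 = 0 := by
  obtain ⟨m, -, hm⟩ := (isLeast_latMin hP 0).1
  have h : (0 : ℝ) = latMin P 0 := by simpa using hm
  exact_mod_cast h.symm

theorem minPairing_toReal {P : Set (ι → ℝ)} (hP : IsLatticePolytope P) (n : ι → ℤ) :
    minPairing P (toReal n) = latMin P n := (isLeast_latMin hP n).csInf_eq

theorem IsLatticePolytope.exists_minPairing {P : Set (ι → ℝ)} (hP : IsLatticePolytope P)
    (u : ι → ℝ) : ∃ p ∈ P, p ⬝ᵥ u = minPairing P u ∧ ∀ m ∈ P, p ⬝ᵥ u ≤ m ⬝ᵥ u := by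
  have hne : P.Nonempty := by
    obtain ⟨s, ⟨v, hv⟩, rfl⟩ := hP
    exact ⟨_, subset_convexHull ℝ _ ⟨v, hv, rfl⟩⟩
  obtain ⟨p, hp, hmin⟩ := hP.isCompact.exists_isMinOn hne
    (continuous_dotProduct_right u).continuousOn
  have h : IsLeast ((fun m => m ⬝ᵥ u) '' P) (p ⬝ᵥ u) := by
    refine ⟨⟨p, hp, rfl⟩, ?_⟩
    rintro _ ⟨m, hm, rfl⟩
    exact hmin hm
  exact ⟨p, hp, h.csInf_eq.symm, hmin⟩

end Polytope

/-! ### The polytopes `∇̂ᵢ` and the nef-partition. -/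

namespace MinkowskiDecomposition

variable {d k : ℕ} (D : MinkowskiDecomposition d k)

/-- The polytope `∇̂₀` in terms of inequalities. -/
def hatPolyhedron : Set (Fin d ⊕ Fin k → ℝ) :=
  {x | ∀ i, ∀ m ∈ D.part i, (if i = 0 then -1 else 0 : ℝ) ≤
    (Sum.elim m (0 : Fin k → ℝ) + toReal (eVec i) : Fin d ⊕ Fin k → ℝ) ⬝ᵥ x}

theorem liftReal_toReal (n : Fin d → ℤ) : D.liftReal (toReal n) =
    toReal (Sum.elim n fun j : Fin k => -latMin (D.part j.succ) n) := by
  ext (j | j)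
  · rfl
  · simp [liftReal, minPairing_toReal (D.isLatticePolytope _), toReal]

theorem liftReal_zero : D.liftReal 0 = 0 := by
  ext (j | j)
  · rfl
  · obtain ⟨p, -, h, -⟩ := (D.isLatticePolytope j.succ).exists_minPairing 0
    simp [liftReal, ← h]

theorem convex_hatPolyhedron : Convex ℝ D.hatPolyhedron := by
  simp only [hatPolyhedron, Set.ofPred_forall]
  refine convex_iInter fun i => convex_iInter₂ fun m _ => ?_
  simp only [dotProduct_comm]
  exact convex_setOf_le_dotProduct _ _

theorem liftReal_mem_hatPolyhedron {u : Fin d → ℝ} (hu : u ∈ polar D.Δ) :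
    D.liftReal u ∈ D.hatPolyhedron := by
  intro i m hm
  choose p hp hpu hmin using fun i => (D.isLatticePolytope i).exists_minPairing u
  rw [liftReal, shift_dotProduct]
  rcases Fin.eq_zero_or_eq_succ i with rfl | ⟨i, rfl⟩
  · have h := hu _ (D.mem_Δ.2 ⟨Fin.cons m fun j => p j.succ, Fin.cases hm fun j => hp _, rfl⟩)
    rw [Fin.sum_univ_succ, add_dotProduct, sum_dotProduct] at h
    simpa [← hpu] using h
  · have := hmin _ m hm
    simp only [Fin.succ_ne_zero, if_false, Fin.cons_succ, ← hpu]
    linarith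

theorem eStar_mem_hatPolyhedron (j : Fin k) : eStar j ∈ D.hatPolyhedron := by
  intro i m hm
  have e : (eStar j : Fin d ⊕ Fin k → ℝ) =
      Sum.elim (0 : Fin d → ℝ) (Pi.single j 1 : Fin k → ℝ) := by
    ext (l | l) <;> simp [eStar, Pi.single_apply]
  rw [e, shift_dotProduct]
  rcases Fin.eq_zero_or_eq_succ i with rfl | ⟨i, rfl⟩
  · simp
  · by_cases h : i = j
    · subst h; simp
    · simp [h]

/-- Let `x = (u, β)`, let `pᵢ` minimise `u` on `Δᵢ`, and let `A = -min ⟨Δ, u⟩`. Then `x` is the lift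
of `u` plus `∑ⱼ (⟨pⱼ, u⟩ + βⱼ) eⱼ^*` with non-negative coefficients. For `u ≠ 0`, `u / A` lies on
the face of `Δ^*` cut out by `∑ pᵢ`; the minima are linear on the cone over it, so the lift of `u`
is a combination of lifts of the given points with total weight `A`. The total weight of all terms
is at most one, and `0` takes up the rest. Using a finite `s` also yields the lattice property of
`∇̂₀`. -/
theorem hatPolyhedron_subset {s : Finset (Fin d → ℤ)}
    (hs : polar D.Δ = convexHull ℝ (toReal '' (s : Set (Fin d → ℤ))))
    {C : Set (Fin d ⊕ Fin k → ℝ)} (hC : Convex ℝ C) (h0 : 0 ∈ C)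
    (hsC : ∀ n ∈ s, D.liftReal (toReal n) ∈ C) (heC : ∀ j, eStar j ∈ C) :
    D.hatPolyhedron ⊆ C := by
  classical
  intro x hx
  obtain ⟨u, β, rfl⟩ : ∃ (u : Fin d → ℝ) (β : Fin k → ℝ), x = Sum.elim u β :=
    ⟨_, _, (Sum.elim_comp_inl_inr x).symm⟩
  choose p hp hpu hmin using fun i => (D.isLatticePolytope i).exists_minPairing u
  have hx0 := hx 0 (p 0) (hp 0)
  have hxj := fun j : Fin k => hx j.succ (p j.succ) (hp _)
  simp only [shift_dotProduct, if_true, Fin.cons_zero, Fin.succ_ne_zero, if_false,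
    Fin.cons_succ] at hx0 hxj
  set A : ℝ := -∑ i, p i ⬝ᵥ u with hA
  have hΔA : ∀ x ∈ D.Δ, -A ≤ x ⬝ᵥ u := by
    intro x hx
    obtain ⟨m, hm, rfl⟩ := D.mem_Δ.1 hx
    rw [hA, neg_neg, sum_dotProduct]
    exact Finset.sum_le_sum fun i _ => hmin i _ (hm i)
  have hA0 : 0 ≤ A := by simpa using hΔA 0 D.zero_mem_Δ
  -- This is the inequality at `p 0 ∈ Δ₀`, the only one with bound `-1`.
  have hb : A + ∑ j, (p j.succ ⬝ᵥ u + β j) ≤ 1 := by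
    rw [hA, Fin.sum_univ_succ, Finset.sum_add_distrib]
    linarith
  obtain ⟨w, hw0, hw1, hwu⟩ : ∃ w : s → ℝ, (∀ y, 0 ≤ w y) ∧ ∑ y, w y ≤ A ∧
      ∑ y, w y • D.liftReal (toReal y.1) = Sum.elim u fun j => -(p j.succ ⬝ᵥ u) := by
    by_cases hu : u = 0
    · refine ⟨0, fun _ => le_rfl, by simpa using hA0, ?_⟩
      ext (j | j) <;> simp [hu]
    obtain ⟨z, hz, hzu⟩ := D.exists_dotProduct_neg hu
    have hA1 : 0 < A := by linarith [hΔA z hz]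
    have hpolar : A⁻¹ • u ∈ polar D.Δ := by
      intro x hx
      have h1 := hΔA x hx
      rw [dotProduct_smul, smul_eq_mul, ← mul_inv_cancel₀ hA1.ne', ← neg_mul, mul_comm (-A)]
      exact mul_le_mul_of_nonneg_left h1 (by positivity)
    have hs' : polar D.Δ = convexHull ℝ ((s.image toReal : Finset (Fin d → ℝ)) : Set _) := by
      rw [Finset.coe_image]; exact hs
    rw [hs', Finset.mem_convexHull'] at hpolar
    obtain ⟨w, hw0, hw1, hw2⟩ := hpolar
    rw [Finset.sum_image toReal_injective.injOn] at hw1 hw2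
    have hp1 : (∑ i, p i) ⬝ᵥ (A⁻¹ • u) = -1 := by
      rw [dotProduct_smul, smul_eq_mul, sum_dotProduct]
      have : ∑ i, p i ⬝ᵥ u = -A := by rw [hA, neg_neg]
      rw [this, mul_neg, inv_mul_cancel₀ hA1.ne']
    have hpΔ : ∑ i, p i ∈ D.Δ := D.mem_Δ.2 ⟨p, hp, rfl⟩
    have hy1 : ∀ y ∈ s, ∀ x ∈ D.Δ, -1 ≤ x ⬝ᵥ toReal y := by
      intro y hy
      have : toReal y ∈ polar D.Δ := by
        rw [hs]
        exact subset_convexHull ℝ _ ⟨y, hy, rfl⟩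
      exact this
    -- The point `∑ pᵢ` has value `-1` at `u / A` and at least `-1` at every `y`, so it has value
    -- `-1` at each `y` of non-zero weight. There it attains the minimum over `Δ`, and hence each
    -- `pᵢ` attains the minimum over `Δᵢ`.
    have key : ∀ y ∈ s, ∀ i, w (toReal y) * (p i ⬝ᵥ toReal y) =
        w (toReal y) * minPairing (D.part i) (toReal y) := by
      intro y hy i
      have h3 : ∑ z ∈ s, w (toReal z) * ((∑ i, p i) ⬝ᵥ toReal z + 1) = 0 := by
        rw [← hw2, dotProduct_sum] at hp1
        simp only [dotProduct_smul, smul_eq_mul] at hp1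
        simp only [mul_add, mul_one, Finset.sum_add_distrib, hw1, hp1]
        norm_num
      have h4 := (Finset.sum_eq_zero_iff_of_nonneg fun z hz =>
        mul_nonneg (hw0 _ (Finset.mem_image_of_mem _ hz))
          (by linarith [hy1 z hz _ hpΔ])).1 h3 y hy
      rcases mul_eq_zero.1 h4 with h5 | h5
      · rw [h5, zero_mul, zero_mul]
      choose q hq hqu hqmin using fun i => (D.isLatticePolytope i).exists_minPairing (toReal y)
      have h6 : ∑ j, (p j ⬝ᵥ toReal y - q j ⬝ᵥ toReal y) = 0 := by
        refine le_antisymm ?_ (Finset.sum_nonneg fun j _ => by linarith [hqmin j _ (hp j)])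
        have h7 := hy1 y hy _ (D.mem_Δ.2 ⟨q, hq, rfl⟩)
        rw [Finset.sum_sub_distrib, ← sum_dotProduct, ← sum_dotProduct]
        linarith
      have h8 := (Finset.sum_eq_zero_iff_of_nonneg fun j _ => by
        linarith [hqmin j _ (hp j)]).1 h6 i (Finset.mem_univ i)
      rw [← hqu]
      congr 1
      linarith
    have hu2 : u = A • ∑ y ∈ s, w (toReal y) • toReal y := by
      rw [hw2, smul_smul, mul_inv_cancel₀ hA1.ne', one_smul]
    refine ⟨fun y => A * w (toReal y.1), fun y => mul_nonneg hA0
      (hw0 _ (Finset.mem_image_of_mem _ y.2)), ?_, ?_⟩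
    · rw [Finset.sum_coe_sort s fun y => A * w (toReal y), ← Finset.mul_sum, hw1, mul_one]
    · rw [Finset.sum_coe_sort s fun y => (A * w (toReal y)) • D.liftReal (toReal y)]
      ext (j | j)
      · conv_rhs => rw [hu2]
        simp [liftReal, Finset.sum_apply, Finset.mul_sum, mul_assoc]
      · conv_rhs => rw [hu2]
        simp only [Sum.elim_inr, dotProduct_smul, dotProduct_sum, smul_eq_mul,
          Finset.sum_apply, Pi.smul_apply, liftReal, Finset.mul_sum, mul_neg,
          Finset.sum_neg_distrib, neg_inj]
        refine Finset.sum_congr rfl fun y hy => ?_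
        rw [key y hy, mul_assoc]
  have hmem := hC.sum_smul_mem_of_zero_mem h0
    (w := (Sum.elim w fun j => p j.succ ⬝ᵥ u + β j : s ⊕ Fin k → ℝ))
    (z := Sum.elim (fun y => D.liftReal (toReal y.1)) eStar) ?_ ?_ ?_
  · refine Set.mem_of_eq_of_mem ?_ hmem
    rw [Fintype.sum_sum_type]
    simp only [Sum.elim_inl, Sum.elim_inr, hwu]
    ext (j | j)
    · simp [eStar, Finset.sum_apply]
    · simp [eStar, Finset.sum_apply, Pi.single_apply]
  · rintro (y | j)
    · exact hw0 y
    · exact hxj j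
  · rw [Fintype.sum_sum_type]
    simp only [Sum.elim_inl, Sum.elim_inr]
    linarith
  · rintro (y | j)
    · exact hsC y.1 y.2
    · exact heC j

theorem hatNabla_zero : D.hatNabla 0 =
    convexHull ℝ (D.liftReal '' polar D.Δ ∪ Set.range eStar) := by
  simp [hatNabla]

theorem zero_mem_polar : (0 : Fin d → ℝ) ∈ polar D.Δ := fun m _ => by simp

theorem zero_mem_hatNabla_zero : 0 ∈ D.hatNabla 0 := by
  rw [hatNabla_zero]
  exact subset_convexHull ℝ _ (Or.inl ⟨0, D.zero_mem_polar, D.liftReal_zero⟩)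

theorem hatNabla_zero_eq : D.hatNabla 0 = D.hatPolyhedron := by
  refine subset_antisymm ?_ ?_
  · rw [hatNabla_zero]
    refine convexHull_min (Set.union_subset ?_ ?_) D.convex_hatPolyhedron
    · rintro _ ⟨u, hu, rfl⟩
      exact D.liftReal_mem_hatPolyhedron hu
    · rintro _ ⟨j, rfl⟩
      exact D.eStar_mem_hatPolyhedron j
  · obtain ⟨s, -, hs⟩ := D.isReflexive.isLatticePolytope_polar
    have h0 := D.zero_mem_hatNabla_zero
    rw [hatNabla_zero] at h0 ⊢
    refine D.hatPolyhedron_subset hs (convex_convexHull ℝ _) h0 (fun n hn => ?_) fun j =>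
      subset_convexHull ℝ _ (Or.inr ⟨j, rfl⟩)
    refine subset_convexHull ℝ _ (Or.inl ⟨_, ?_, rfl⟩)
    change toReal n ∈ polar (∑ i, D.part i)
    rw [hs]
    exact subset_convexHull ℝ _ ⟨n, hn, rfl⟩

theorem eStar_eq (j : Fin k) :
    (eStar j : Fin d ⊕ Fin k → ℝ) = toReal (Pi.single (Sum.inr j) 1) := by
  ext l
  by_cases h : l = Sum.inr j
  · subst h; simp [eStar, toReal]
  · simp [eStar, toReal, h]

theorem isLatticePolytope_hatNabla_zero : IsLatticePolytope (D.hatNabla 0) := by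
  classical
  obtain ⟨s, -, hs⟩ := D.isReflexive.isLatticePolytope_polar
  -- The point `0` is added to the generators because `hatPolyhedron_subset` puts the remaining
  -- weight on it.
  let T : Finset (Fin d ⊕ Fin k → ℤ) := insert 0
    (s.image (fun n => Sum.elim n fun j : Fin k => -latMin (D.part j.succ) n) ∪
      Finset.univ.image fun j => Pi.single (Sum.inr j) 1)
  have hT0 : (0 : Fin d ⊕ Fin k → ℤ) ∈ T := Finset.mem_insert_self _ _
  have hTs : ∀ n ∈ s, (Sum.elim n fun j : Fin k => -latMin (D.part j.succ) n) ∈ T := fun n hn =>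
    Finset.mem_insert_of_mem (Finset.mem_union_left _ (Finset.mem_image_of_mem _ hn))
  have hTe : ∀ j : Fin k, (Pi.single (Sum.inr j) 1 : Fin d ⊕ Fin k → ℤ) ∈ T := fun j =>
    Finset.mem_insert_of_mem (Finset.mem_union_right _
      (Finset.mem_image_of_mem _ (Finset.mem_univ j)))
  refine ⟨T, ⟨0, hT0⟩, subset_antisymm ?_ ?_⟩
  · rw [hatNabla_zero_eq]
    refine D.hatPolyhedron_subset hs (convex_convexHull ℝ _) ?_ (fun n hn => ?_) fun j => ?_
    · exact subset_convexHull ℝ _ ⟨0, hT0, toReal_zero⟩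
    · exact subset_convexHull ℝ _ ⟨_, hTs n hn, (D.liftReal_toReal n).symm⟩
    · exact subset_convexHull ℝ _ ⟨_, hTe j, (eStar_eq j).symm⟩
  · refine convexHull_min ?_ (D.hatNabla_zero ▸ convex_convexHull ℝ _)
    rintro _ ⟨v, hv, rfl⟩
    rcases Finset.mem_insert.1 hv with rfl | hv
    · rw [toReal_zero]
      exact D.zero_mem_hatNabla_zero
    rcases Finset.mem_union.1 hv with hv | hv
    · obtain ⟨n, hn, rfl⟩ := Finset.mem_image.1 hv
      rw [← liftReal_toReal, hatNabla_zero_eq]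
      refine D.liftReal_mem_hatPolyhedron ?_
      change toReal n ∈ polar (∑ i, D.part i)
      rw [hs]
      exact subset_convexHull ℝ _ ⟨n, hn, rfl⟩
    · obtain ⟨j, -, rfl⟩ := Finset.mem_image.1 hv
      rw [← eStar_eq, hatNabla_zero_eq]
      exact D.eStar_mem_hatPolyhedron j

theorem mem_hatNabla {i : Fin (k + 1)} {x : Fin d ⊕ Fin k → ℝ} : x ∈ D.hatNabla i ↔
    x + (Fin.cons 0 eStar : Fin (k + 1) → Fin d ⊕ Fin k → ℝ) i ∈ D.hatNabla 0 := by
  rw [hatNabla_zero, hatNabla]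
  constructor
  · rintro ⟨y, hy, rfl⟩
    simpa using hy
  · intro h
    exact ⟨_, h, by simp⟩

theorem isLatticePolytope_hatNabla (i : Fin (k + 1)) : IsLatticePolytope (D.hatNabla i) := by
  obtain ⟨v, hv⟩ : ∃ v : Fin d ⊕ Fin k → ℤ,
      (Fin.cons 0 eStar : Fin (k + 1) → Fin d ⊕ Fin k → ℝ) i = toReal v := by
    rcases Fin.eq_zero_or_eq_succ i with rfl | ⟨j, rfl⟩
    · exact ⟨0, by simp⟩
    · exact ⟨_, by rw [Fin.cons_succ, eStar_eq]⟩
  have h := D.isLatticePolytope_hatNabla_zero.add (IsLatticePolytope.singleton (-v))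
  have e : D.hatNabla 0 + {toReal (-v)} = D.hatNabla i := by
    ext x
    rw [mem_hatNabla, hv, Set.add_singleton, toReal_neg]
    constructor
    · rintro ⟨y, hy, rfl⟩
      simpa using hy
    · intro hx
      exact ⟨_, hx, by simp⟩
  rwa [e] at h

theorem zero_mem_hatNabla (i : Fin (k + 1)) : 0 ∈ D.hatNabla i := by
  rw [mem_hatNabla, zero_add]
  rcases Fin.eq_zero_or_eq_succ i with rfl | ⟨j, rfl⟩
  · exact D.zero_mem_hatNabla_zero
  · rw [Fin.cons_succ, hatNabla_zero_eq]
    exact D.eStar_mem_hatPolyhedron j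

theorem sum_eStar : (∑ i, (Fin.cons 0 eStar : Fin (k + 1) → Fin d ⊕ Fin k → ℝ) i) =
    Sum.elim (0 : Fin d → ℝ) (1 : Fin k → ℝ) := by
  rw [Fin.sum_univ_succ]
  ext (j | j)
  · simp [eStar, Finset.sum_apply]
  · simp [eStar, Finset.sum_apply, Pi.single_apply]

theorem shift_dotProduct_sum_eStar (i : Fin (k + 1)) (m : Fin d → ℝ) :
    (Sum.elim m (0 : Fin k → ℝ) + toReal (eVec i) : Fin d ⊕ Fin k → ℝ) ⬝ᵥ
        Sum.elim (0 : Fin d → ℝ) (1 : Fin k → ℝ) =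
      if i = 0 then -(k : ℝ) else 1 := by
  rw [shift_dotProduct]
  rcases Fin.eq_zero_or_eq_succ i with rfl | ⟨j, rfl⟩
  · simp
  · simp

theorem mem_polar_tilde {x : Fin d ⊕ Fin k → ℝ} : x ∈ polar D.tilde ↔ ∀ i, ∀ m ∈ D.part i, -1 ≤
    (Sum.elim m (0 : Fin k → ℝ) + toReal (eVec i) : Fin d ⊕ Fin k → ℝ) ⬝ᵥ x := by
  constructor
  · exact fun h i m hm => h _ (D.shifted_subset_tilde i ⟨m, hm, rfl⟩)
  · intro h
    rw [tilde_eq]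
    refine mem_polar_convexHull ?_
    rintro y (rfl | hy)
    · simp
    · obtain ⟨i, m, hm, rfl⟩ := Set.mem_iUnion.1 hy
      exact h i m hm

/-- All summands are translates of `∇̂₀`. The total translation pairs to `-k` with `Δ₀ + e₀` and to
`1` with the other `Δᵢ + eᵢ`, so the bounds become `-(k + 1) + k = -1` and `0 - 1 = -1`: the
inequalities of the polar. -/
theorem sum_hatNabla : ∑ i, D.hatNabla i = polar D.tilde := by
  ext x
  rw [mem_polar_tilde, Set.mem_fintype_sum]
  constructor
  · rintro ⟨y, hy, rfl⟩ i m hm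
    have h1 := fun l => D.mem_hatNabla.1 (hy l)
    rw [hatNabla_zero_eq] at h1
    have h2 := Finset.sum_le_sum fun l (_ : l ∈ Finset.univ) => h1 l i m hm
    rw [← dotProduct_sum, Finset.sum_add_distrib, sum_eStar, dotProduct_add,
      shift_dotProduct_sum_eStar, Finset.sum_const, Finset.card_univ, Fintype.card_fin,
      nsmul_eq_mul] at h2
    split_ifs at h2
    · push_cast at h2
      linarith
    · linarith
  · intro h
    set c := (Fin.cons 0 eStar : Fin (k + 1) → Fin d ⊕ Fin k → ℝ) with hc
    have hk : (0 : ℝ) < k + 1 := by positivity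
    -- After undoing the translations, `x` is divided into `k + 1` equal parts, each of which lies
    -- in `∇̂₀`.
    refine ⟨fun i => (k + 1 : ℝ)⁻¹ • (x + Sum.elim (0 : Fin d → ℝ) (1 : Fin k → ℝ)) - c i,
      fun i => ?_, ?_⟩
    · rw [mem_hatNabla, ← hc, sub_add_cancel, hatNabla_zero_eq]
      intro l m hm
      have h1 := h l m hm
      rw [dotProduct_smul, dotProduct_add, shift_dotProduct_sum_eStar, smul_eq_mul,
        inv_mul_eq_div, le_div_iff₀ hk]
      split_ifs <;> linarith
    · rw [Finset.sum_sub_distrib, sum_eStar, Finset.sum_const, Finset.card_univ,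
        Fintype.card_fin, ← Nat.cast_smul_eq_nsmul ℝ, smul_smul]
      push_cast
      rw [mul_inv_cancel₀ hk.ne', one_smul, add_sub_cancel_right]

theorem polar_sum_hatNabla : polar (∑ i, D.hatNabla i) = D.tilde := by
  rw [sum_hatNabla, polar_polar D.isLatticePolytope_tilde D.zero_mem_tilde]

theorem isNefPartition_hatNabla : IsNefPartition D.hatNabla :=
  ⟨⟨IsLatticePolytope.sum _ D.isLatticePolytope_hatNabla,
    D.sum_hatNabla ▸ zero_mem_interior_polar D.isLatticePolytope_tilde,
    D.polar_sum_hatNabla ▸ D.isLatticePolytope_tilde⟩,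
    fun i => ⟨D.isLatticePolytope_hatNabla i, D.zero_mem_hatNabla i⟩⟩

/-! ### Divisors of the rays, and the equations in homogeneous coordinates. -/

theorem coxExp_r {v : D.Ray} {l : Fin (k + 1)} (hv : toReal v.1 ∈ D.shifted l) (i : Fin (k + 1)) :
    D.coxExp (D.r i).1 v = if l = i then 1 else 0 := by
  obtain ⟨m, hm, h⟩ := hv
  have e := D.coxExp_eq (D.r i).1 v h hm
  have h0 : toReal ((D.r i).1 ∘ Sum.inl) = 0 := by
    ext j
    simp [r, toReal]
  rw [h0, dotProduct_zero, zero_add] at e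
  have h1 : D.coxExp (D.r i).1 v = (D.r i).1 (Sum.inr l) := by exact_mod_cast e
  exact h1

theorem coxExp_r_eq_divisor (i : Fin (k + 1)) (v : D.Ray) :
    D.coxExp (D.r i).1 v = D.divisor i v := by
  obtain ⟨l, hl⟩ := D.exists_mem_shifted v
  rw [divisor]
  split_ifs with h
  · rw [D.coxExp_r h, if_pos rfl]
  · rw [D.coxExp_r hl, if_neg]
    rintro rfl
    exact h hl

theorem divisor_eq {v : D.Ray} {l : Fin (k + 1)} (hv : toReal v.1 ∈ D.shifted l)
    (i : Fin (k + 1)) : D.divisor i v = if l = i then 1 else 0 := by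
  rw [← coxExp_r_eq_divisor, D.coxExp_r hv]

theorem ray_inr (v : D.Ray) (i : Fin k) :
    v.1 (Sum.inr i) = D.divisor i.succ v - D.divisor 0 v := by
  have h := D.coxExp_r_eq_divisor i.succ v
  simp only [coxExp, r, dotProduct, Fintype.sum_sum_type, Sum.elim_inl, Sum.elim_inr,
    Function.comp_apply, Pi.zero_apply, mul_zero, Finset.sum_const_zero, Fin.succ_inj, mul_ite,
    mul_one, Finset.sum_ite_eq', Finset.mem_univ, if_true, zero_add, one_mul] at h
  lia

/-- The inequalities bound the minimum below by `-1` or `0`, and `0 ∈ ∇̂₀` bounds it above by `0`.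
On `Δ₀ + e₀` it remains to see that it is negative; integrality then forces `-1`. -/
theorem latMin_hatNabla_zero (v : D.Ray) : latMin (D.hatNabla 0) v.1 = -D.divisor 0 v := by
  have hL := isLeast_latMin (D.isLatticePolytope_hatNabla 0) v.1
  set L := latMin (D.hatNabla 0) v.1
  obtain ⟨l, hl⟩ := D.exists_mem_shifted v
  have h0 : L ≤ 0 := by
    have : (L : ℝ) ≤ 0 := hL.2 ⟨0, D.zero_mem_hatNabla 0, zero_dotProduct _⟩
    exact_mod_cast this
  have h1 : -D.divisor 0 v ≤ L := by
    obtain ⟨x, hx, hxL⟩ := hL.1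
    obtain ⟨m, hm, h⟩ := hl
    rw [hatNabla_zero_eq] at hx
    have h2 := hx l m hm
    have h3 : ((Sum.elim m (0 : Fin k → ℝ) + toReal (eVec l) : Fin d ⊕ Fin k → ℝ)) ⬝ᵥ x = L := by
      rw [← hxL, ← h, dotProduct_comm]
    rw [h3] at h2
    rw [D.divisor_eq ⟨m, hm, h⟩]
    split_ifs at h2 ⊢ <;> exact_mod_cast h2
  rw [D.divisor_eq hl] at h1 ⊢
  split_ifs at h1 ⊢ with hl0
  swap
  · exact le_antisymm (by simpa using h0) h1
  suffices h : L < 0 by lia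
  obtain ⟨m, hm, h⟩ := hl
  -- Some `x` in the polar of `Δ̃₀ ⊎ ⋯ ⊎ Δ̃_k` is negative on `v`. Splitting it into summands and
  -- translating them to `∇̂₀` gives `(k + 1) L ≤ ⟨x, v⟩ - k < 0`.
  obtain ⟨x, hx, hxv⟩ := exists_dotProduct_neg_of_mem_interior
    (zero_mem_interior_polar D.isLatticePolytope_tilde) (u := toReal v.1)
    (fun h => v.2.2 (toReal_eq_zero.1 h))
  rw [← sum_hatNabla, Set.mem_fintype_sum] at hx
  obtain ⟨y, hy, rfl⟩ := hx
  have h2 := Finset.sum_le_sum fun i (_ : i ∈ Finset.univ) =>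
    hL.2 ⟨_, D.mem_hatNabla.1 (hy i), rfl⟩
  have h3 := shift_dotProduct_sum_eStar l m
  rw [if_pos hl0, dotProduct_comm, ← sum_eStar] at h3
  rw [← h] at h2 hxv
  simp only [← sum_dotProduct, Finset.sum_add_distrib, Finset.sum_const, Finset.card_univ,
    Fintype.card_fin, nsmul_eq_mul] at h2
  rw [add_dotProduct, h3] at h2
  by_contra! hL0
  have h4 : (0 : ℝ) ≤ L := by exact_mod_cast hL0
  have h5 : (0 : ℝ) ≤ ((k + 1 : ℕ) : ℝ) * L := by positivity
  have h6 : (0 : ℝ) ≤ k := by positivity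
  linarith

theorem latMin_hatNabla (i : Fin (k + 1)) (v : D.Ray) :
    latMin (D.hatNabla i) v.1 = -D.divisor i v := by
  rcases Fin.eq_zero_or_eq_succ i with rfl | ⟨i, rfl⟩
  · exact D.latMin_hatNabla_zero v
  have h0 := isLeast_latMin (D.isLatticePolytope_hatNabla 0) v.1
  have he : (eStar i : Fin d ⊕ Fin k → ℝ) ⬝ᵥ toReal v.1 = v.1 (Sum.inr i) := by
    simp [eStar, toReal]
  have h1 : IsLeast ((fun m => m ⬝ᵥ toReal v.1) '' D.hatNabla i.succ)
      ((latMin (D.hatNabla 0) v.1 - v.1 (Sum.inr i) : ℤ) : ℝ) := by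
    constructor
    · obtain ⟨x, hx, hxv⟩ := h0.1
      refine ⟨x - eStar i, ?_, ?_⟩
      · rw [mem_hatNabla, Fin.cons_succ, sub_add_cancel]
        exact hx
      · push_cast
        rw [← hxv, ← he]
        exact sub_dotProduct _ _ _
    · rintro _ ⟨x, hx, rfl⟩
      rw [mem_hatNabla, Fin.cons_succ] at hx
      have := h0.2 ⟨_, hx, rfl⟩
      simp only [add_dotProduct, he] at this
      push_cast
      linarith
  have h2 : latMin (D.hatNabla i.succ) v.1 = latMin (D.hatNabla 0) v.1 - v.1 (Sum.inr i) := by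
    exact_mod_cast (isLeast_latMin (D.isLatticePolytope_hatNabla i.succ) v.1).unique h1
  rw [h2, latMin_hatNabla_zero, ray_inr]
  ring

open Classical in
/-- The exponents of the terms of `D.fBar`. -/
noncomputable def fBarExponent (n : D.DualPoint) : D.monoid := if n = 0 then D.r 0 else D.lift n.1

theorem fBar_eq_sum (a : D.DualPoint → ℂ) :
    D.fBar a = ∑ n, a n • D.chi (D.fBarExponent n) := by
  classical
  rw [fBar, ← Finset.add_sum_erase _ _ (Finset.mem_univ (0 : D.DualPoint)), Finset.filter_ne',
    fBarExponent, if_pos rfl]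
  congr 1
  refine Finset.sum_congr rfl fun n hn => ?_
  rw [fBarExponent, if_neg (Finset.ne_of_mem_erase hn)]

/-- The exceptional exponent `r₀^*` at `n = 0` fits the uniform formula, since all minima vanish
there and only the factor over `Δ₀ + e₀` remains. -/
theorem coxExp_fBarExponent (n : D.DualPoint) :
    D.coxExp (D.fBarExponent n).1 = D.expFBar n.1 := by
  funext v
  rw [fBarExponent]
  split_ifs with h
  · have h0 : n.1 = 0 := congrArg Subtype.val h
    rw [coxExp_r_eq_divisor, expFBar, h0]
    simp [latMin_zero (D.isLatticePolytope _), dotProduct, Fintype.sum_sum_type]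
  · have h1 : ∑ i, (D.lift n.1).1 (Sum.inr i) = 1 := by
      simp [lift, D.sum_latMin, D.latMin_Δ n h]
    rw [coxExp, h1, one_mul]
    rfl

/-- With a single summand every ray lies in it, so the divisor contributes the full product `∏ x_ρ`.
-/
theorem coxExp_levelOne (n : D.DualPoint) :
    D.total.coxExp (D.levelOne n).1 = D.expF n.1 := by
  funext v
  obtain ⟨l, hl⟩ := D.total.exists_mem_shifted v
  have h1 : D.total.divisor 0 v = 1 := by
    rw [D.total.divisor_eq hl, if_pos (Fin.fin_one_eq_zero l)]
  rw [coxExp, h1, expF]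
  simp [levelOne, dotProduct, Fintype.sum_sum_type]

theorem coxMap_fBar (a : D.DualPoint → ℂ) : D.coxMap (D.fBar a) = D.FBar a := by
  rw [fBar_eq_sum, map_sum, FBar]
  refine Finset.sum_congr rfl fun n _ => ?_
  rw [coxMap_smul, coxMap_chi, coxExp_fBarExponent]

theorem coxMap_g (i : Fin k) : D.coxMap (D.g i) = D.G i := by
  rw [g, map_sub, coxMap_chi, coxMap_chi, G, funext (D.coxExp_r_eq_divisor i.succ),
    funext (D.coxExp_r_eq_divisor 0)]

theorem coxMap_f (a : D.DualPoint → ℂ) : D.total.coxMap (D.f a) = D.F a := by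
  rw [f, map_sum, F]
  refine Finset.sum_congr rfl fun n _ => ?_
  rw [coxMap_smul, coxMap_chi, coxExp_levelOne]

theorem FBar_mem_sections (a : D.DualPoint → ℂ) : D.FBar a ∈ D.sections (D.hatNabla 0) := by
  refine Submodule.sum_mem _ fun n _ => Submodule.smul_mem _ _ (Submodule.subset_span
    ⟨Sum.elim n.1 fun j => -latMin (D.part j.succ) n.1, ?_, ?_⟩)
  · rw [← liftReal_toReal, hatNabla_zero_eq]
    exact D.liftReal_mem_hatPolyhedron n.2
  · congr 1
    funext v
    rw [latMin_hatNabla, sub_neg_eq_add, dotProduct_comm, expFBar]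

/-- The two monomials belong to the lattice points `0` and `-eᵢ^*` of `∇̂ᵢ`. For the second, the
coordinate of `v_ρ` along `eᵢ` is the difference of the two divisors, by `ray_inr`. -/
theorem G_mem_sections (i : Fin k) : D.G i ∈ D.sections (D.hatNabla i.succ) := by
  refine Submodule.sub_mem _ (Submodule.subset_span ⟨0, ?_, ?_⟩)
    (Submodule.subset_span ⟨-Pi.single (Sum.inr i) 1, ?_, ?_⟩)
  · rw [toReal_zero]
    exact D.zero_mem_hatNabla _
  · congr 1
    funext v
    rw [latMin_hatNabla, sub_neg_eq_add, zero_dotProduct, zero_add]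
  · rw [mem_hatNabla, Fin.cons_succ, toReal_neg, ← eStar_eq, neg_add_cancel]
    exact D.zero_mem_hatNabla 0
  · congr 1
    funext v
    rw [latMin_hatNabla, neg_dotProduct, single_dotProduct, ray_inr]
    ring

/-! ### Comparing the hypersurface with the complete intersection. -/

theorem isClosedImmersion_embedding : IsClosedImmersion D.embedding :=
  isClosedImmersion_projMap _ D.ringProj_surjective _

/-- Both morphisms come from surjective graded homomorphisms out of `Ā`, and `ker_comp` says that
these have the same kernel. -/
theorem ker_closedSubschemeι_idealCI (a : D.DualPoint → ℂ) :
    (closedSubschemeι (D.idealCI a)).ker =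
      (closedSubschemeι (D.idealY a) ≫ D.embedding).ker := by
  have h1 := isClosedImmersion_closedSubschemeι (D.idealCI a)
  have hle := irrelevant_le_map_of_surjective _ (D.surjective_comp a)
  have h2 := isClosedImmersion_projMap _ (D.surjective_comp a) hle
  have e : closedSubschemeι (D.idealY a) ≫ D.embedding = Proj.map _ hle :=
    (Proj.map_comp _ _ _ _).symm
  rw [e]
  have hq1 : QuasiCompact (closedSubschemeι (D.idealCI a)) := inferInstance
  have hq2 : QuasiCompact (Proj.map _ hle) := inferInstance
  exact @ker_projMap_congr _ _ _ _ _ _ _ _ _ _ _ _ _ _ _ _ _ _ _ _ _ _ _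
    (irrelevant_le_map_of_surjective _ Ideal.Quotient.mk_surjective) hle hq1 hq2
    ((ker_quotMap _).trans (D.ker_comp a).symm)

theorem exists_closedSubscheme_iso (a : D.DualPoint → ℂ) :
    ∃ φ : closedSubscheme (D.idealY a) ≅ closedSubscheme (D.idealCI a),
      φ.hom ≫ closedSubschemeι (D.idealCI a) = closedSubschemeι (D.idealY a) ≫ D.embedding := by
  have h1 := isClosedImmersion_closedSubschemeι (D.idealCI a)
  have h2 := isClosedImmersion_closedSubschemeι (D.idealY a)
  have h3 := D.isClosedImmersion_embedding
  have h := D.ker_closedSubschemeι_idealCI a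
  have := IsClosedImmersion.isIso_lift _ _ h
  exact ⟨asIso (IsClosedImmersion.lift _ _ h.le), IsClosedImmersion.lift_fac _ _ _⟩

theorem coxSubscheme_F (a : D.DualPoint → ℂ) :
    D.total.coxSubscheme (Ideal.span {D.F a}) = (closedSubschemeι (D.idealY a)).ker := by
  rw [← coxSubscheme_map, idealY, Ideal.map_span, Set.image_singleton, coxMap_f]

theorem coxSubscheme_FBar (a : D.DualPoint → ℂ) :
    D.coxSubscheme (Ideal.span (insert (D.FBar a) (Set.range D.G))) =
      (closedSubschemeι (D.idealCI a)).ker := by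
  rw [← coxSubscheme_map, idealCI, Ideal.map_span, Set.image_insert_eq, coxMap_fBar,
    ← Set.range_comp, Function.comp_def, funext D.coxMap_g]

end MinkowskiDecomposition

end ToricCY

theorem mainTheorem3 {d k : ℕ} (D : ToricCY.MinkowskiDecomposition d k) (a : D.DualPoint → ℂ) :
    -- `X_{Δ^*} → X_{(Δ̃₀ ⊎ ⋯ ⊎ Δ̃_k)^*}` is a closed embedding, and the hypersurface and the
    -- complete intersection are closed subschemes
    IsClosedImmersion D.embedding ∧
    IsClosedImmersion (ToricCY.closedSubschemeι (D.idealY a)) ∧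
    IsClosedImmersion (ToricCY.closedSubschemeι (D.idealCI a)) ∧
    -- the embedding maps the hypersurface isomorphically onto the complete intersection
    (∃ φ : ToricCY.closedSubscheme (D.idealY a) ≅ ToricCY.closedSubscheme (D.idealCI a),
      φ.hom ≫ ToricCY.closedSubschemeι (D.idealCI a) =
        ToricCY.closedSubschemeι (D.idealY a) ≫ D.embedding) ∧
    -- the graded map onto the quotient by `f` is surjective, with the stated kernel
    Function.Surjective ((ToricCY.quotMap (D.idealY a)).comp D.ringProj) ∧
    RingHom.ker ((ToricCY.quotMap (D.idealY a)).comp D.ringProj) =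
      Ideal.span (insert (D.fBar a) (Set.range D.g)) ∧
    -- the equations form a complete intersection
    (a ≠ 0 → RingTheory.Sequence.IsRegular D.Ring (List.ofFn D.g ++ [D.fBar a])) ∧
    -- it is a nef Calabi-Yau complete intersection: the ambient variety is the toric variety of a
    -- nef-partition, and the equations are sections of the corresponding line bundles
    ToricCY.IsNefPartition D.hatNabla ∧
    ToricCY.polar (∑ i, D.hatNabla i) = D.tilde ∧
    D.FBar a ∈ D.sections (D.hatNabla 0) ∧
    (∀ i : Fin k, D.G i ∈ D.sections (D.hatNabla i.succ)) ∧
    -- the exponents in homogeneous coordinates are non-negative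
    (∀ (n : D.DualPoint) (v : D.total.Ray), 0 ≤ D.expF n.1 v) ∧
    (∀ (n : D.DualPoint) (v : D.Ray), 0 ≤ D.expFBar n.1 v) ∧
    -- the hypersurface in homogeneous coordinates
    D.total.coxSubscheme (Ideal.span {D.F a}) = (ToricCY.closedSubschemeι (D.idealY a)).ker ∧
    -- the image of the hypersurface in homogeneous coordinates
    (D.total.coxSubscheme (Ideal.span {D.F a})).map D.embedding =
      D.coxSubscheme (Ideal.span (insert (D.FBar a) (Set.range D.G))) := by
  exact ⟨D.isClosedImmersion_embedding, ToricCY.isClosedImmersion_closedSubschemeι _,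
    ToricCY.isClosedImmersion_closedSubschemeι _, D.exists_closedSubscheme_iso a,
    D.surjective_comp a, D.ker_comp a, D.isRegular, D.isNefPartition_hatNabla,
    D.polar_sum_hatNabla, D.FBar_mem_sections a, D.G_mem_sections,
    fun n v => D.coxExp_levelOne n ▸ D.total.coxExp_nonneg (D.levelOne n) v,
    fun n v => D.coxExp_fBarExponent n ▸ D.coxExp_nonneg (D.fBarExponent n) v,
    D.coxSubscheme_F a, by
      rw [D.coxSubscheme_F, D.coxSubscheme_FBar, Scheme.IdealSheafData.map_ker,
        D.ker_closedSubschemeι_idealCI]⟩
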